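/- Let $S^3\subset\mathbb H$ be the unit quaternions with the round metric, and let $A(x)=xi$, $B(x)=xj$, $C(x)=xk$ be the standard left-invariant orthonormal vector fields; for a vector field $V$ and a function $f$ let $Vf$ be the derivative of $f$ along $V$. Let $\mathcal H$ be the Hopf fibration whose fibers are the great circle orbits of $A$, oriented by $A$; let $\alpha=\langle A,\cdot\rangle$ be the standard contact form and $\xi=\ker\alpha$ the standard contact structure. Let $\mathrm{Aut}(\mathcal H)$ be the group of $C^\infty$ diffeomorphisms of $S^3$ that permute the oriented fibers of $\mathcal H$ (not necessarily rigidly), $\mathrm{Aut}(\xi)$ the group of diffeomorphisms $F$ with $F_*\xi=\xi$, and $\mathrm{Aut}_1(\xi)$ the group of diffeomorphisms $F$ with $F^*\alpha=\alpha$. For such a group $G$, the tangent space $T_{\mathrm{id}}G$ is the set of vector fields $X(x)=\frac{d}{dt}\big|_{t=0}F_t(x)$, where $F_t$, $|t|<\varepsilon$, is a $C^\infty$ curve in $G$ (that is, $(t,x)\mapsto F_t(x)$ is $C^\infty$) with $F_0=\mathrm{id}$. Below, $f,g,h$ denote $C^\infty$ real-valued functions on $S^3$. (a) $T_{\mathrm{id}}\mathrm{Aut}(\mathcal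 H)$ is the set of vector fields $X=fA+gB+hC$ such that $f$ is any smooth function on $S^3$, $g=-\tfrac12 Ah$ and $h=\tfrac12 Ag$. (b) $T_{\mathrm{id}}\mathrm{Aut}(\xi)$ is the set of vector fields $X=fA+gB+hC$ such that $f$ is any smooth function on $S^3$, $g=\tfrac12 Cf$ and $h=-\tfrac12 Bf$. (c) $T_{\mathrm{id}}\mathrm{Aut}_1(\xi)$ is the set of vector fields $X=fA+gB+hC$ such that $Af=0$, $g=\tfrac12 Cf$ and $h=-\tfrac12 Bf$. For every such field, $f$ is constant along the fibers of $\mathcal H$ and $X$ is divergence-free. -/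

import Mathlib

noncomputable section

namespace HopfContact

open Set Module
open scoped Manifold ContDiff Quaternion InnerProductSpace

instance factFinrankQuaternion : Fact (finrank ℝ ℍ[ℝ] = 3 + 1) :=
  ⟨Quaternion.finrank_eq_four⟩

/-- The three-sphere of unit quaternions, with Mathlib's smooth structure on spheres. -/
abbrev S3 : Type := Metric.sphere (0 : ℍ[ℝ]) 1

/-- The tangent space of `S3` at `x`. -/
abbrev T (x : S3) : Type := TangentSpace (𝓡 3) x

/-- Vector fields on `S3` (not necessarily continuous). -/
abbrev VectorField : Type := (x : S3) → T x

/-- The group of `C^∞` diffeomorphisms of `S3`. -/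
abbrev Diff : Type := S3 ≃ₘ⟮𝓡 3, 𝓡 3⟯ S3

/-- The differential of the inclusion of `S3` into the quaternions. -/
def inclDeriv (x : S3) : T x →L[ℝ] ℍ[ℝ] :=
  mvfderiv (𝓡 3) (Subtype.val : S3 → ℍ[ℝ]) x

theorem exists_inclDeriv_eq (x : S3) (w : ℍ[ℝ]) (hw : ⟪(x : ℍ[ℝ]), w⟫_ℝ = 0) :
    ∃ v : T x, inclDeriv x v = w := by
  have h := range_mvfderiv_subtypeVal (n := 3) x
  have hw' : w ∈ (ℝ ∙ (x : ℍ[ℝ]))ᗮ := Submodule.mem_orthogonal_singleton_iff_inner_right.mpr hw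
  rw [← h] at hw'
  exact hw'

theorem inner_mul_left_eq_zero (x q : ℍ[ℝ]) (hq : q.re = 0) : ⟪x, x * q⟫_ℝ = 0 := by
  rw [Quaternion.inner_def]
  simp [hq]
  ring

/-- The left-invariant vector field `x ↦ x q` on `S3`, for an imaginary quaternion `q`. -/
def leftInvField (q : ℍ[ℝ]) (hq : q.re = 0) : VectorField := fun x =>
  Classical.choose (exists_inclDeriv_eq x (x * q) (inner_mul_left_eq_zero x q hq))

/-- The defining property, which determines the field because `inclDeriv x` is injective. -/
theorem inclDeriv_leftInvField (q : ℍ[ℝ]) (hq : q.re = 0) (x : S3) :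
    inclDeriv x (leftInvField q hq x) = x * q :=
  Classical.choose_spec (exists_inclDeriv_eq x (x * q) (inner_mul_left_eq_zero x q hq))

/-- The quaternion `i`. -/
def quatI : ℍ[ℝ] := ⟨0, 1, 0, 0⟩

/-- The quaternion `j`. -/
def quatJ : ℍ[ℝ] := ⟨0, 0, 1, 0⟩

/-- The quaternion `k`. -/
def quatK : ℍ[ℝ] := ⟨0, 0, 0, 1⟩

/-- `A(x) = x i`, the Hopf vector field. -/
def fieldA : VectorField := leftInvField quatI rfl

/-- `B(x) = x j`. -/
def fieldB : VectorField := leftInvField quatJ rfl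

/-- `C(x) = x k`. -/
def fieldC : VectorField := leftInvField quatK rfl

/-- `C^∞` real-valued functions on `S3`. -/
def IsSmooth (f : S3 → ℝ) : Prop := ContMDiff (𝓡 3) 𝓘(ℝ, ℝ) ∞ f

/-- The derivative `V f` of the function `f` along the vector field `V`. -/
def dirDeriv (V : VectorField) (f : S3 → ℝ) : S3 → ℝ := fun x =>
  mvfderiv (𝓡 3) f x (V x)

/-- The vector field `f A + g B + h C`. -/
def combo (f g h : S3 → ℝ) : VectorField := fun x =>
  f x • fieldA x + g x • fieldB x + h x • fieldC x

/-- The divergence of a vector field on the Riemannian manifold `S3`: the trace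
`∑ ⟪∇_E X, E⟫` over the orthonormal frame `A, B, C`, where the Levi-Civita derivative `∇_E X` is
the tangential part of the derivative of `X` as a quaternion-valued map. -/
def divergence (X : VectorField) (x : S3) : ℝ :=
  let D : T x →L[ℝ] ℍ[ℝ] :=
    mvfderiv (𝓡 3) (fun y : S3 => inclDeriv y (X y)) x
  ⟪D (fieldA x), inclDeriv x (fieldA x)⟫_ℝ + ⟪D (fieldB x), inclDeriv x (fieldB x)⟫_ℝ
    + ⟪D (fieldC x), inclDeriv x (fieldC x)⟫_ℝ

/-- The Hopf fiber through `x`: the points of `S3` on the complex line through `x`, where `ℂ` acts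
on the quaternions by right multiplication. -/
def hopfFiber (x : S3) : Set S3 := {y | ∃ z : ℂ, (y : ℍ[ℝ]) = (x : ℍ[ℝ]) * (z : ℍ[ℝ])}

/-- The standard contact form `α = ⟪A, ·⟫`. -/
def contactForm (x : S3) : T x →ₗ[ℝ] ℝ :=
  (innerₛₗ ℝ (inclDeriv x (fieldA x))).comp (inclDeriv x).toLinearMap

/-- The standard contact structure `ξ = ker α`. -/
def contactPlane (x : S3) : Submodule ℝ (T x) := LinearMap.ker (contactForm x)

/-- The differential of a diffeomorphism. -/
def diffDeriv (F : Diff) (x : S3) : T x →L[ℝ] T (F x) := mfderiv (𝓡 3) (𝓡 3) F x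

/-- Automorphisms of the Hopf fibration: diffeomorphisms that permute the Hopf fibers, oriented
by the Hopf vector field. -/
def AutHopf : Set Diff :=
  {F | ∀ x, F '' hopfFiber x = hopfFiber (F x) ∧
    ∃ c : ℝ, 0 < c ∧ diffDeriv F x (fieldA x) = c • fieldA (F x)}

/-- Contactomorphisms: diffeomorphisms whose differential maps `ξ` at `x` onto `ξ` at `F x`. -/
def AutContact : Set Diff :=
  {F | ∀ x, (contactPlane x).map (diffDeriv F x).toLinearMap = contactPlane (F x)}

/-- Strict contactomorphisms: diffeomorphisms with `F^* α = α`. -/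
def AutContactStrict : Set Diff :=
  {F | ∀ x v, contactForm (F x) (diffDeriv F x v) = contactForm x v}

/-- The tangent space at the identity of a set `G` of diffeomorphisms: the initial velocities
`X(x) = d/dt F_t(x)` at `t = 0` of `C^∞` curves `F_t` in `G`, defined for `|t| < ε`, with
`F_0 = id`. Smoothness of the curve in the diffeomorphism group of the compact manifold `S3` is
smoothness of `(t, x) ↦ F_t(x)`. -/
def tangentAtId (G : Set Diff) : Set VectorField :=
  {X | ∃ ε : ℝ, 0 < ε ∧ ∃ F : ℝ → Diff,
    ContMDiffOn (𝓘(ℝ, ℝ).prod (𝓡 3)) (𝓡 3) ∞ (fun p : ℝ × S3 => F p.1 p.2)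
      (Ioo (-ε) ε ×ˢ univ) ∧
    (∀ t ∈ Ioo (-ε) ε, F t ∈ G) ∧
    (∀ x, F 0 x = x) ∧
    ∀ x, HasDerivAt (fun t : ℝ => (F t x : ℍ[ℝ])) (inclDeriv x (X x)) 0}

end HopfContact

end

noncomputable section

namespace HopfContact

open Set Module
open scoped Manifold ContDiff Quaternion InnerProductSpace Topology

/-! Functions and maps on the sphere are extended to the nonzero quaternions by composing with the
radial projection `nrm`, so that all differentiation takes place in `ℍ[ℝ]`.

Necessity. Write `X(x) = x u(x)` with `u = f i + g j + h k`. For `V(x) = x a` and a quaternion `b`,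
the pairing `⟪dF_t(V), F_t(x) b⟫` has derivative `⟪a u + V u, b⟫ + ⟪a, u b⟫` at `t = 0`; symmetry of
mixed partials is what brings in `V u` (`hasDerivAt_pairing`). In each group suitable pairings are
constant in `t`. The pairs `(a, b) = (i, j), (i, k)` give the Hopf equations, `(j, i), (k, i)` the
contact equations, and `(i, i)` gives `Af = 0`.

Sufficiency in the Hopf case. The equations say that `(g, h)` rotates with speed 2 along fibers,
which is exactly what makes `x ↦ x (1 + t (g j + h k))` commute with the Hopf flow. Multiplying on
the right by `exp(t f i)` moves points only within fibers and adds the component `f A`.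

Sufficiency in the contact case needs no flow. Extend `f` to the Hamiltonian `H` of degree two, with
Hamiltonian field `X_H` on `ℍ[ℝ]`. The Liouville form `λ_q = ⟪q i, ·⟫` is invariant under `X_H`, so
the Euler step `E_t = id + t X_H` satisfies `E_t^* λ = λ + O(t²)` with an error exactly quadratic,
hence even, in `t` (`inner_eulerStep`). Therefore `E_{t/2} ∘ E_{-t/2}⁻¹`, the implicit midpoint
rule, preserves `λ`. Its radial projection rescales `α` by a quotient of squared norms, and this
quotient is 1 when `Af = 0`, because then `X_H` is tangent to the sphere.

Both constructions start from maps homogeneous of degree one and close to the identity;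
`IsHomFamily.exists_diffeo` turns these into smooth curves of diffeomorphisms. The divergence claim
follows from `[B, C] = 2A`. -/

/-! ### Radial projection, and calculus on the sphere through radial extensions -/

theorem norm_coe_S3 (x : S3) : ‖(x : ℍ[ℝ])‖ = 1 := norm_eq_of_mem_sphere x

theorem coe_S3_ne_zero (x : S3) : (x : ℍ[ℝ]) ≠ 0 := ne_zero_of_mem_unit_sphere x

/-- The radial projection of the quaternions onto the unit sphere (with value `1` at `0`). -/
def nrm (q : ℍ[ℝ]) : S3 :=
  open Classical in
  if h : q = 0 then ⟨1, by simp⟩ else ⟨‖q‖⁻¹ • q, by simp [norm_smul, h]⟩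

theorem coe_nrm {q : ℍ[ℝ]} (h : q ≠ 0) : (nrm q : ℍ[ℝ]) = ‖q‖⁻¹ • q := by
  simp [nrm, h]

@[simp]
theorem nrm_coe (x : S3) : nrm x = x := by
  ext1
  rw [coe_nrm (coe_S3_ne_zero x)]
  simp

theorem nrm_smul {r : ℝ} (hr : 0 < r) (q : ℍ[ℝ]) : nrm (r • q) = nrm q := by
  by_cases h : q = 0
  · simp [h]
  · ext1
    rw [coe_nrm h, coe_nrm (smul_ne_zero hr.ne' h), norm_smul, smul_smul, Real.norm_of_nonneg hr.le]
    congr 1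
    field_simp

theorem norm_smul_nrm (q : ℍ[ℝ]) : ‖q‖ • (nrm q : ℍ[ℝ]) = q := by
  by_cases h : q = 0
  · simp [h]
  · rw [coe_nrm h, smul_smul, mul_inv_cancel₀ (norm_ne_zero_iff.2 h), one_smul]

theorem contMDiffAt_nrm {q : ℍ[ℝ]} (h : q ≠ 0) : ContMDiffAt 𝓘(ℝ, ℍ[ℝ]) (𝓡 3) ∞ nrm q := by
  let U : TopologicalSpace.Opens ℍ[ℝ] := ⟨{0}ᶜ, isOpen_compl_singleton⟩
  have h1 : ContMDiff 𝓘(ℝ, ℍ[ℝ]) 𝓘(ℝ, ℍ[ℝ]) ∞ (fun q : U => ‖(q : ℍ[ℝ])‖⁻¹ • (q : ℍ[ℝ])) := by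
    intro p
    have : ContDiffAt ℝ ∞ (fun q : ℍ[ℝ] => ‖q‖⁻¹ • q) (p : ℍ[ℝ]) :=
      ((contDiffAt_norm ℝ p.2).inv (norm_ne_zero_iff.2 p.2)).smul contDiffAt_id
    exact (contMDiffAt_subtype_iff (U := U) (x := p)).2 this.contMDiffAt
  have h2 : ∀ q : U, ‖(q : ℍ[ℝ])‖⁻¹ • (q : ℍ[ℝ]) ∈ Metric.sphere (0 : ℍ[ℝ]) 1 := by
    intro q
    have : (q : ℍ[ℝ]) ≠ 0 := q.2
    simp [norm_smul, this]
  have h3 := h1.codRestrict_sphere (n := 3) h2 ⟨q, h⟩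
  refine (contMDiffAt_subtype_iff (U := U) (x := ⟨q, h⟩)).1 ?_
  exact h3.congr_of_eventuallyEq (Filter.Eventually.of_forall fun p => Subtype.ext (coe_nrm p.2))

theorem contMDiff_val : ContMDiff (𝓡 3) 𝓘(ℝ, ℍ[ℝ]) ∞ (Subtype.val : S3 → ℍ[ℝ]) :=
  contMDiff_coe_sphere

section
variable {E : Type*} [NormedAddCommGroup E] [NormedSpace ℝ E]

theorem contDiffAt_comp_nrm {f : S3 → E} (hf : ContMDiff (𝓡 3) 𝓘(ℝ, E) ∞ f) {q : ℍ[ℝ]}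
    (hq : q ≠ 0) : ContDiffAt ℝ ∞ (fun q => f (nrm q)) q :=
  contMDiffAt_iff_contDiffAt.1 ((hf (nrm q)).comp q (contMDiffAt_nrm hq))

theorem contMDiff_comp_val {f : ℍ[ℝ] → E} (hf : ∀ q ≠ 0, ContDiffAt ℝ ∞ f q) :
    ContMDiff (𝓡 3) 𝓘(ℝ, E) ∞ (fun x : S3 => f x) := fun x =>
  (hf x (coe_S3_ne_zero x)).contMDiffAt.comp x (contMDiff_val x)

/-- Since `f = (f ∘ nrm) ∘ Subtype.val`, this is the chain rule. It replaces manifold derivatives by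
Fréchet derivatives on `ℍ[ℝ]` throughout. -/
theorem mvfderiv_eq_fderiv {f : S3 → E} (hf : ContMDiff (𝓡 3) 𝓘(ℝ, E) ∞ f) (x : S3) (v : T x) :
    (mvfderiv (𝓡 3) f x v : E) = fderiv ℝ (fun q => f (nrm q)) x (inclDeriv x v) := by
  have h1 := (contDiffAt_comp_nrm hf (coe_S3_ne_zero x)).differentiableAt (by simp)
  have h2 : f = (fun q => f (nrm q)) ∘ Subtype.val := by funext y; simp
  have h3 := h1.mdifferentiableAt.hasMFDerivAt.comp x
    ((contMDiff_val x).mdifferentiableAt (by simp)).hasMFDerivAt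
  rw [← h2] at h3
  have h4 := h3.mfderiv
  change mfderiv _ _ f x v = _
  rw [h4, mfderiv_eq_fderiv]
  rfl

end

theorem inclDeriv_injective (x : S3) : Function.Injective (inclDeriv x) :=
  injective_mvfderiv_subtypeVal_sphere (n := 3) x

theorem inner_inclDeriv (x : S3) (v : T x) : ⟪(x : ℍ[ℝ]), inclDeriv x v⟫_ℝ = 0 := by
  have h := range_mvfderiv_subtypeVal (n := 3) x
  exact Submodule.mem_orthogonal_singleton_iff_inner_right.mp (h ▸ ⟨v, rfl⟩)

theorem fderiv_nrm {x : S3} {w : ℍ[ℝ]} (hw : ⟪(x : ℍ[ℝ]), w⟫_ℝ = 0) :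
    fderiv ℝ (fun q => (nrm q : ℍ[ℝ])) x w = w := by
  obtain ⟨v, rfl⟩ := exists_inclDeriv_eq x w hw
  exact (mvfderiv_eq_fderiv contMDiff_val x v).symm

theorem inclDeriv_diffDeriv (F : Diff) (x : S3) (v : T x) :
    inclDeriv (F x) (diffDeriv F x v) = fderiv ℝ (fun q => (F (nrm q) : ℍ[ℝ])) x (inclDeriv x v) := by
  have hF : ContMDiff (𝓡 3) (𝓡 3) ∞ F := F.contMDiff_toFun
  rw [← mvfderiv_eq_fderiv (f := fun y => (F y : ℍ[ℝ])) (contMDiff_val.comp hF)]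
  have h3 := ((contMDiff_val (F x)).mdifferentiableAt (by simp)).hasMFDerivAt.comp x
    ((hF x).mdifferentiableAt (by simp)).hasMFDerivAt
  exact (congrArg (fun L => L v) h3.mfderiv).symm

/-- Smoothness in time and space of a family of self-maps of `S3`, in terms of the radial
extension to the quaternions. -/
theorem contDiffAt_family {I : Set ℝ} (hI : IsOpen I) {F : ℝ → S3 → S3}
    (hF : ContMDiffOn (𝓘(ℝ, ℝ).prod (𝓡 3)) (𝓡 3) ∞ (fun p : ℝ × S3 => F p.1 p.2) (I ×ˢ univ))
    {t : ℝ} (ht : t ∈ I) {q : ℍ[ℝ]} (hq : q ≠ 0) :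
    ContDiffAt ℝ ∞ (fun p : ℝ × ℍ[ℝ] => (F p.1 (nrm p.2) : ℍ[ℝ])) (t, q) := by
  have h1 := (hF (t, nrm q) ⟨ht, mem_univ _⟩).contMDiffAt ((hI.prod isOpen_univ).mem_nhds ⟨ht, mem_univ _⟩)
  have h2 : ContMDiffAt (𝓘(ℝ, ℝ).prod 𝓘(ℝ, ℍ[ℝ])) (𝓘(ℝ, ℝ).prod (𝓡 3)) ∞
      (fun p : ℝ × ℍ[ℝ] => (p.1, nrm p.2)) (t, q) :=
    contMDiffAt_fst.prodMk ((contMDiffAt_nrm hq).comp (t, q) contMDiffAt_snd)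
  have h3 := ((contMDiff_val _).comp (t, nrm q) h1).comp (t, q) h2
  rw [chartedSpaceSelf_prod, ← modelWithCornersSelf_prod] at h3
  exact contMDiffAt_iff_contDiffAt.1 h3

theorem contMDiffOn_family {I : Set ℝ} {F : ℝ → S3 → S3} {P : ℝ → ℍ[ℝ] → ℍ[ℝ]}
    (hP : ∀ t ∈ I, ∀ q ≠ 0, ContDiffAt ℝ ∞ (fun p : ℝ × ℍ[ℝ] => P p.1 p.2) (t, q))
    (h0 : ∀ t ∈ I, ∀ x : S3, P t x ≠ 0)
    (hF : ∀ t ∈ I, ∀ x, F t x = nrm (P t x)) :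
    ContMDiffOn (𝓘(ℝ, ℝ).prod (𝓡 3)) (𝓡 3) ∞ (fun p : ℝ × S3 => F p.1 p.2) (I ×ˢ univ) := by
  refine ContMDiffOn.congr (f := fun p : ℝ × S3 => nrm (P p.1 p.2)) ?_
    (fun p hp => hF p.1 hp.1 p.2)
  rintro ⟨t, x⟩ ⟨ht, -⟩
  have h1 := (hP t ht x (coe_S3_ne_zero x)).contMDiffAt
  rw [modelWithCornersSelf_prod, ← chartedSpaceSelf_prod] at h1
  have h2 : ContMDiffAt (𝓘(ℝ, ℝ).prod (𝓡 3)) (𝓘(ℝ, ℝ).prod 𝓘(ℝ, ℍ[ℝ])) ∞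
      (fun p : ℝ × S3 => (p.1, (p.2 : ℍ[ℝ]))) (t, x) :=
    contMDiffAt_fst.prodMk ((contMDiff_val x).comp (t, x) contMDiffAt_snd)
  exact ((contMDiffAt_nrm (h0 t ht x)).comp (t, x) (h1.comp (t, x) h2)).contMDiffWithinAt

/-! ### From homogeneous families to diffeomorphisms of the sphere -/

/-- A smooth family of self-maps of the quaternions, positively homogeneous of degree one and
smooth away from the origin, which starts at the identity. -/
structure IsHomFamily (P : ℝ → ℍ[ℝ] → ℍ[ℝ]) : Prop where
  smooth : ∀ t, ∀ q ≠ 0, ContDiffAt ℝ ∞ (fun p : ℝ × ℍ[ℝ] => P p.1 p.2) (t, q)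
  hom : ∀ t, ∀ r : ℝ, 0 < r → ∀ q, P t (r • q) = r • P t q
  id_zero : ∀ q ≠ 0, P 0 q = q

namespace IsHomFamily

variable {P : ℝ → ℍ[ℝ] → ℍ[ℝ]}

theorem map_zero (hP : IsHomFamily P) (t : ℝ) : P t 0 = 0 := by
  have h := hP.hom t 2 two_pos 0
  rw [smul_zero, two_smul] at h
  exact left_eq_add.1 h

theorem hasFDerivAt (hP : IsHomFamily P) (t : ℝ) {q : ℍ[ℝ]} (hq : q ≠ 0) :
    HasFDerivAt (P t) ((fderiv ℝ (fun p : ℝ × ℍ[ℝ] => P p.1 p.2) (t, q)).comp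
      (ContinuousLinearMap.inr ℝ ℝ ℍ[ℝ])) q :=
  ((hP.smooth t q hq).differentiableAt (by simp)).hasFDerivAt.comp q (hasFDerivAt_prodMk_right t q)

theorem fderiv_smul (hP : IsHomFamily P) (t : ℝ) {r : ℝ} (hr : 0 < r) (q : ℍ[ℝ]) :
    fderiv ℝ (P t) (r • q) = fderiv ℝ (P t) q := by
  have h : (fun q => P t (r • q)) = r • P t := by
    funext q; exact hP.hom t r hr q
  have h1 : fderiv ℝ (fun q => P t (r • q)) q = r • fderiv ℝ (P t) (r • q) := fderiv_comp_smul _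
  rw [h, fderiv_const_smul_field] at h1
  exact (smul_right_injective _ hr.ne' h1).symm

theorem fderiv_self (hP : IsHomFamily P) (t : ℝ) {q : ℍ[ℝ]} (hq : q ≠ 0) :
    fderiv ℝ (P t) q q = P t q := by
  have h1 : HasDerivAt (fun s : ℝ => s • q) q 1 := by
    simpa using (hasDerivAt_id (1 : ℝ)).smul_const q
  have h2 : HasFDerivAt (P t) (fderiv ℝ (P t) q) ((1 : ℝ) • q) := by
    rw [one_smul]; exact (hP.hasFDerivAt t hq).differentiableAt.hasFDerivAt
  have h3 := h2.comp_hasDerivAt 1 h1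
  have h4 : HasDerivAt (fun s : ℝ => s • P t q) (P t q) 1 := by
    simpa using (hasDerivAt_id (1 : ℝ)).smul_const (P t q)
  refine h3.unique (h4.congr_of_eventuallyEq ?_)
  filter_upwards [lt_mem_nhds one_pos] with s hs
  exact hP.hom t s hs q

/-- At `t = 0` the derivative is the identity, and it is continuous in `(t, q)`. Compactness of the
unit sphere makes the estimate uniform there, and homogeneity of degree zero of the derivative
carries it to every nonzero `q`. -/
theorem exists_fderiv_bound (hP : IsHomFamily P) : ∃ ε : ℝ, 0 < ε ∧ ∀ t ∈ Ioo (-ε) ε, ∀ q ≠ 0,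
    ‖fderiv ℝ (P t) q - ContinuousLinearMap.id ℝ ℍ[ℝ]‖ ≤ 1 / 2 := by
  have h1 : ∀ x ∈ Metric.sphere (0 : ℍ[ℝ]) 1, ∀ᶠ z : ℝ × ℍ[ℝ] in 𝓝 (0, x),
      ‖fderiv ℝ (P z.1) z.2 - ContinuousLinearMap.id ℝ ℍ[ℝ]‖ < 1 / 2 := by
    intro x hx
    have hx0 : x ≠ 0 := by
      rintro rfl
      simp at hx
    have hc : ContinuousAt (fun z : ℝ × ℍ[ℝ] =>
        ‖(fderiv ℝ (fun p : ℝ × ℍ[ℝ] => P p.1 p.2) z).comp (ContinuousLinearMap.inr ℝ ℝ ℍ[ℝ])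
          - ContinuousLinearMap.id ℝ ℍ[ℝ]‖) (0, x) := by
      have := ((hP.smooth 0 x hx0).fderiv_right (m := 0) (by simp)).continuousAt
      exact ((this.clm_comp continuousAt_const).sub continuousAt_const).norm
    have h0 : fderiv ℝ (P 0) x = ContinuousLinearMap.id ℝ ℍ[ℝ] := by
      refine ((hasFDerivAt_id x).congr_of_eventuallyEq ?_).fderiv
      filter_upwards [isOpen_compl_singleton.mem_nhds hx0] with q hq
      exact hP.id_zero q hq
    have h2 := hc.eventually_lt_const (u := 1 / 2) (by
      beta_reduce
      rw [← (hP.hasFDerivAt 0 hx0).fderiv, h0, sub_self]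
      exact (norm_zero (E := ℍ[ℝ] →L[ℝ] ℍ[ℝ])).trans_lt (by norm_num))
    have h3 : ∀ᶠ z : ℝ × ℍ[ℝ] in 𝓝 (0, x), z.2 ≠ 0 :=
      continuousAt_snd.eventually_ne hx0
    filter_upwards [h2, h3] with z hz hz0
    rwa [(hP.hasFDerivAt z.1 hz0).fderiv]
  have h2 := (isCompact_sphere (0 : ℍ[ℝ]) 1).eventually_forall_of_forall_eventually
    (P := fun t q => ‖fderiv ℝ (P t) q - ContinuousLinearMap.id ℝ ℍ[ℝ]‖ < 1 / 2) h1
  obtain ⟨ε, hε, h3⟩ := Metric.eventually_nhds_iff.1 h2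
  refine ⟨ε, hε, fun t ht q hq => ?_⟩
  have h4 := h3 (y := t) (by rw [Real.dist_eq, sub_zero]; exact abs_lt.2 ht) (nrm q) (nrm q).2
  rw [coe_nrm hq, hP.fderiv_smul t (inv_pos.2 (norm_pos_iff.2 hq))] at h4
  exact h4.le

/-- By Euler's identity, `P t q - q` is the value of `fderiv ℝ (P t) q - id` at `q` itself. -/
theorem norm_sub_le (hP : IsHomFamily P) {t : ℝ}
    (ht : ∀ q ≠ 0, ‖fderiv ℝ (P t) q - ContinuousLinearMap.id ℝ ℍ[ℝ]‖ ≤ 1 / 2) (q : ℍ[ℝ]) :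
    ‖P t q - q‖ ≤ 1 / 2 * ‖q‖ := by
  rcases eq_or_ne q 0 with rfl | hq
  · simp [hP.map_zero]
  · have h := (fderiv ℝ (P t) q - ContinuousLinearMap.id ℝ ℍ[ℝ]).le_of_opNorm_le (ht q hq) q
    simpa [hP.fderiv_self t hq] using h

/-- This is the mean value inequality on the segment from `q` to `p`, except that `P t` need not be
differentiable at the origin. If the segment meets the origin, then `‖p‖ + ‖q‖ = ‖p - q‖` and the
two displacement bounds add up to the same estimate. -/
theorem approximatesLinearOn (hP : IsHomFamily P) {t : ℝ}
    (ht : ∀ q ≠ 0, ‖fderiv ℝ (P t) q - ContinuousLinearMap.id ℝ ℍ[ℝ]‖ ≤ 1 / 2) :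
    ApproximatesLinearOn (P t) (ContinuousLinearEquiv.refl ℝ ℍ[ℝ] : ℍ[ℝ] →L[ℝ] ℍ[ℝ]) univ
      (1 / 2) := by
  intro p _ q _
  simp only [ContinuousLinearEquiv.coe_refl, ContinuousLinearMap.id_apply, NNReal.coe_div,
    NNReal.coe_one, NNReal.coe_ofNat]
  rw [show P t p - P t q - (p - q) = (P t p - p) - (P t q - q) by abel]
  by_cases h0 : (0 : ℍ[ℝ]) ∈ segment ℝ q p
  · have h1 := dist_add_dist_of_mem_segment h0
    rw [dist_zero_right, dist_zero_left, dist_eq_norm, norm_sub_rev] at h1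
    rw [← h1]
    have := hP.norm_sub_le ht p
    have := hP.norm_sub_le ht q
    linarith [_root_.norm_sub_le (P t p - p) (P t q - q)]
  · refine (convex_segment q p).norm_image_sub_le_of_norm_hasFDerivWithin_le
      (f := fun q => P t q - q) (f' := fun q => fderiv ℝ (P t) q - ContinuousLinearMap.id ℝ ℍ[ℝ])
      (fun z hz => ?_) (fun z hz => ht z ?_) (left_mem_segment ℝ q p) (right_mem_segment ℝ q p)
    · have hz0 : z ≠ 0 := by rintro rfl; exact h0 hz
      exact ((hP.hasFDerivAt t hz0).differentiableAt.hasFDerivAt.sub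
        (hasFDerivAt_id z)).hasFDerivWithinAt
    · rintro rfl; exact h0 hz

/-- A map of all of `ℍ[ℝ]` that differs from the identity by a `1/2`-Lipschitz map is injective and
surjective, because `1/2 < ‖id‖⁻¹ = 1`. -/
theorem bijective (hP : IsHomFamily P) {t : ℝ}
    (ht : ∀ q ≠ 0, ‖fderiv ℝ (P t) q - ContinuousLinearMap.id ℝ ℍ[ℝ]‖ ≤ 1 / 2) :
    Function.Bijective (P t) := by
  have h := hP.approximatesLinearOn ht
  have hc : Subsingleton ℍ[ℝ] ∨ (1 / 2 : NNReal) <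
      ‖((ContinuousLinearEquiv.refl ℝ ℍ[ℝ]).symm : ℍ[ℝ] →L[ℝ] ℍ[ℝ])‖₊⁻¹ := by
    right
    have : ‖((ContinuousLinearEquiv.refl ℝ ℍ[ℝ]).symm : ℍ[ℝ] →L[ℝ] ℍ[ℝ])‖₊ = 1 := by
      ext
      simp
    rw [this, inv_one]
    exact NNReal.half_lt_self one_ne_zero
  exact ⟨injOn_univ.1 (h.injOn hc), h.surjective hc⟩

/-- The inverse of a bijective homogeneous family is smooth away from the origin. -/
theorem contDiffAt_inverse (hP : IsHomFamily P) {I : Set ℝ} (hI : IsOpen I)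
    (hb : ∀ t ∈ I, ∀ q ≠ 0, ‖fderiv ℝ (P t) q - ContinuousLinearMap.id ℝ ℍ[ℝ]‖ ≤ 1 / 2)
    {R : ℝ → ℍ[ℝ] → ℍ[ℝ]} (hR : ∀ t ∈ I, ∀ q, R t (P t q) = q)
    {t : ℝ} (ht : t ∈ I) {q : ℍ[ℝ]} (hq : q ≠ 0) :
    ContDiffAt ℝ ∞ (fun p : ℝ × ℍ[ℝ] => R p.1 p.2) (t, P t q) := by
  let Θ : ℝ × ℍ[ℝ] → ℝ × ℍ[ℝ] := fun p => (p.1, P p.1 p.2)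
  have hΘ : ContDiffAt ℝ ∞ Θ (t, q) := contDiffAt_fst.prodMk (hP.smooth t q hq)
  let D := fderiv ℝ (fun p : ℝ × ℍ[ℝ] => P p.1 p.2) (t, q)
  let L : ℝ × ℍ[ℝ] →L[ℝ] ℝ × ℍ[ℝ] := (ContinuousLinearMap.fst ℝ ℝ ℍ[ℝ]).prod D
  have hL : HasFDerivAt Θ L (t, q) :=
    hasFDerivAt_fst.prodMk ((hP.smooth t q hq).differentiableAt (by simp)).hasFDerivAt
  -- A kernel vector has zero time component, and its space component `v` satisfies `‖v‖ ≤ ‖v‖ / 2`.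
  -- In finite dimension injectivity suffices for the inverse function theorem.
  have hinj : Function.Injective L.toLinearMap := by
    rw [← LinearMap.ker_eq_bot, LinearMap.ker_eq_bot']
    rintro ⟨s, v⟩ hsv
    have h1 : s = 0 := congrArg Prod.fst hsv
    subst h1
    have h2 : D (0, v) = 0 := congrArg Prod.snd hsv
    have h3 : fderiv ℝ (P t) q v = 0 := by
      rw [(hP.hasFDerivAt t hq).fderiv]
      exact h2
    have h4 := (fderiv ℝ (P t) q - ContinuousLinearMap.id ℝ ℍ[ℝ]).le_of_opNorm_le (hb t ht q hq) v
    simp only [sub_apply, h3, ContinuousLinearMap.id_apply, zero_sub, norm_neg] at h4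
    have h5 : v = 0 := norm_eq_zero.1 (by linarith [norm_nonneg v])
    rw [h5]
    rfl
  let e : (ℝ × ℍ[ℝ]) ≃L[ℝ] ℝ × ℍ[ℝ] :=
    (LinearEquiv.ofInjectiveEndo L.toLinearMap hinj).toContinuousLinearEquiv
  have he : HasFDerivAt Θ (e : ℝ × ℍ[ℝ] →L[ℝ] ℝ × ℍ[ℝ]) (t, q) := by
    convert hL using 1
    ext <;> rfl
  have h1 := hΘ.to_localInverse he (by simp)
  have h2 := contDiffAt_snd.comp _ h1
  refine h2.congr_of_eventuallyEq ?_
  let ph := hΘ.toOpenPartialHomeomorph Θ he (by simp)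
  have h3 : ∀ᶠ y in 𝓝 (Θ (t, q)), Θ (hΘ.localInverse he (by simp) y) = y := by
    have := ph.open_target.mem_nhds (hΘ.image_mem_toOpenPartialHomeomorph_target he (by simp))
    filter_upwards [this] with y hy
    exact ph.right_inv hy
  have h4 : ∀ᶠ y : ℝ × ℍ[ℝ] in 𝓝 (Θ (t, q)), y.1 ∈ I :=
    continuousAt_fst.eventually (hI.mem_nhds ht)
  filter_upwards [h3, h4] with y hy hy1
  set z := hΘ.localInverse he (by simp) y with hz
  have h5 : z.1 = y.1 := congrArg Prod.fst (a₁ := Θ z) hy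
  have h6 : P z.1 z.2 = y.2 := congrArg Prod.snd (a₁ := Θ z) hy
  change R y.1 y.2 = z.2
  rw [← h6, h5, hR _ hy1]

/-- For small times, a homogeneous family induces diffeomorphisms of the sphere. -/
theorem exists_diffeo (hP : IsHomFamily P) : ∃ ε : ℝ, 0 < ε ∧ ∃ Q : ℝ → Diff,
    (∀ t ∈ Ioo (-ε) ε, ∀ x : S3, P t x ≠ 0 ∧ Q t x = nrm (P t x)) ∧
    ContMDiffOn (𝓘(ℝ, ℝ).prod (𝓡 3)) (𝓡 3) ∞ (fun p : ℝ × S3 => Q p.1 p.2)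
      (Ioo (-ε) ε ×ˢ univ) ∧
    ContMDiffOn (𝓘(ℝ, ℝ).prod (𝓡 3)) (𝓡 3) ∞ (fun p : ℝ × S3 => (Q p.1).symm p.2)
      (Ioo (-ε) ε ×ˢ univ) := by
  obtain ⟨ε, hε, hb⟩ := hP.exists_fderiv_bound
  let R : ℝ → ℍ[ℝ] → ℍ[ℝ] := fun t => Function.invFun (P t)
  have hRP : ∀ t ∈ Ioo (-ε) ε, ∀ q, R t (P t q) = q := fun t ht =>
    Function.leftInverse_invFun (hP.bijective (hb t ht)).1
  have hPR : ∀ t ∈ Ioo (-ε) ε, ∀ q, P t (R t q) = q := fun t ht =>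
    Function.rightInverse_invFun (hP.bijective (hb t ht)).2
  have hP0 : ∀ t ∈ Ioo (-ε) ε, ∀ q ≠ 0, P t q ≠ 0 := fun t ht q hq h =>
    hq ((hP.bijective (hb t ht)).1 (h.trans (hP.map_zero t).symm))
  have hR0 : ∀ t ∈ Ioo (-ε) ε, ∀ q ≠ 0, R t q ≠ 0 := fun t ht q hq h => by
    have := hPR t ht q
    rw [h, hP.map_zero] at this
    exact hq this.symm
  have hRs : ∀ t ∈ Ioo (-ε) ε, ∀ q ≠ 0,
      ContDiffAt ℝ ∞ (fun p : ℝ × ℍ[ℝ] => R p.1 p.2) (t, q) := fun t ht q hq => by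
    have := hP.contDiffAt_inverse isOpen_Ioo hb hRP ht (hR0 t ht q hq)
    rwa [hPR t ht] at this
  have hRh : ∀ t ∈ Ioo (-ε) ε, ∀ r : ℝ, 0 < r → ∀ q, R t (r • q) = r • R t q := fun t ht r hr q => by
    apply (hP.bijective (hb t ht)).1
    rw [hPR t ht, hP.hom t r hr, hPR t ht]
  have slice : ∀ {G : ℝ → ℍ[ℝ] → ℍ[ℝ]} {t : ℝ},
      (∀ q ≠ 0, ContDiffAt ℝ ∞ (fun p : ℝ × ℍ[ℝ] => G p.1 p.2) (t, q)) →
      (∀ q ≠ 0, G t q ≠ 0) →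
      ContMDiff (𝓡 3) (𝓡 3) ∞ (fun x : S3 => nrm (G t x)) := by
    intro G t hG hG0 x
    have h1 : ContDiffAt ℝ ∞ (G t) (x : ℍ[ℝ]) :=
      (hG x (coe_S3_ne_zero x)).comp (x : ℍ[ℝ]) (contDiffAt_const.prodMk contDiffAt_id)
    exact (contMDiffAt_nrm (hG0 x (coe_S3_ne_zero x))).comp x
      (h1.contMDiffAt.comp x (contMDiff_val x))
  have main : ∀ t ∈ Ioo (-ε) ε, ∃ Q : Diff, (∀ x : S3, Q x = nrm (P t x)) ∧
      ∀ x : S3, Q.symm x = nrm (R t x) := by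
    intro t ht
    -- `P t` and its inverse `R t` are both homogeneous of degree one, so they permute rays and
    -- their normalisations are mutually inverse.
    refine ⟨⟨⟨fun x => nrm (P t x), fun x => nrm (R t x), fun x => ?_, fun x => ?_⟩,
      slice (hP.smooth t) (hP0 t ht), slice (hRs t ht) (hR0 t ht)⟩, fun x => rfl, fun x => rfl⟩
    · have h := hP0 t ht x (coe_S3_ne_zero x)
      beta_reduce
      rw [coe_nrm h, hRh t ht _ (inv_pos.2 (norm_pos_iff.2 h)), hRP t ht,
        nrm_smul (inv_pos.2 (norm_pos_iff.2 h)), nrm_coe]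
    · have h := hR0 t ht x (coe_S3_ne_zero x)
      beta_reduce
      rw [coe_nrm h, hP.hom t _ (inv_pos.2 (norm_pos_iff.2 h)), hPR t ht,
        nrm_smul (inv_pos.2 (norm_pos_iff.2 h)), nrm_coe]
  have : Nonempty Diff := ⟨Diffeomorph.refl (𝓡 3) S3 ∞⟩
  choose! Q hQ hQs using main
  exact ⟨ε, hε, Q, fun t ht x => ⟨hP0 t ht x (coe_S3_ne_zero x), hQ t ht x⟩,
    contMDiffOn_family (fun t _ => hP.smooth t) (fun t ht x => hP0 t ht x (coe_S3_ne_zero x)) hQ,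
    contMDiffOn_family hRs (fun t ht x => hR0 t ht x (coe_S3_ne_zero x)) hQs⟩

end IsHomFamily

/-! ### Quaternion algebra and the left-invariant frame -/

theorem inner_eq_sum (p q : ℍ[ℝ]) :
    ⟪p, q⟫_ℝ = p.re * q.re + p.imI * q.imI + p.imJ * q.imJ + p.imK * q.imK := by
  rw [Quaternion.inner_def]
  simp

theorem inner_mul_mul (x : S3) (p q : ℍ[ℝ]) : ⟪(x : ℍ[ℝ]) * p, x * q⟫_ℝ = ⟪p, q⟫_ℝ := by
  have h : (star (x : ℍ[ℝ]) * x) = 1 := by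
    rw [Quaternion.star_mul_self, Quaternion.normSq_eq_norm_mul_self, norm_coe_S3]
    simp
  have h1 : ⟪(x : ℍ[ℝ]) * p, x * q⟫_ℝ = ⟪star (x : ℍ[ℝ]) * x * p, q⟫_ℝ := by
    simp only [inner_eq_sum, Quaternion.re_mul, Quaternion.imI_mul, Quaternion.imJ_mul,
      Quaternion.imK_mul, Quaternion.re_star, Quaternion.imI_star, Quaternion.imJ_star,
      Quaternion.imK_star]
    ring
  rw [h1, h, one_mul]

@[simp] theorem re_quatI : quatI.re = 0 := rfl

@[simp] theorem imI_quatI : quatI.imI = 1 := rfl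

@[simp] theorem imJ_quatI : quatI.imJ = 0 := rfl

@[simp] theorem imK_quatI : quatI.imK = 0 := rfl

@[simp] theorem re_quatJ : quatJ.re = 0 := rfl

@[simp] theorem imI_quatJ : quatJ.imI = 0 := rfl

@[simp] theorem imJ_quatJ : quatJ.imJ = 1 := rfl

@[simp] theorem imK_quatJ : quatJ.imK = 0 := rfl

@[simp] theorem re_quatK : quatK.re = 0 := rfl

@[simp] theorem imI_quatK : quatK.imI = 0 := rfl

@[simp] theorem imJ_quatK : quatK.imJ = 0 := rfl

@[simp] theorem imK_quatK : quatK.imK = 1 := rfl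

/-- The imaginary quaternion with the given coefficients. -/
def imVec (f g h : ℝ) : ℍ[ℝ] := f • quatI + g • quatJ + h • quatK

@[simp] theorem re_imVec (f g h : ℝ) : (imVec f g h).re = 0 := by
  simp [imVec]

@[simp] theorem imI_imVec (f g h : ℝ) : (imVec f g h).imI = f := by
  simp [imVec]

@[simp] theorem imJ_imVec (f g h : ℝ) : (imVec f g h).imJ = g := by
  simp [imVec]

@[simp] theorem imK_imVec (f g h : ℝ) : (imVec f g h).imK = h := by
  simp [imVec]

/-- Left multiplication by a unit quaternion is an isometry, so `x i, x j, x k` is an orthonormal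
basis of the tangent space. -/
theorem mul_imVec_inner {x : S3} {w : ℍ[ℝ]} (hw : ⟪(x : ℍ[ℝ]), w⟫_ℝ = 0) :
    (x : ℍ[ℝ]) * imVec ⟪w, x * quatI⟫_ℝ ⟪w, x * quatJ⟫_ℝ ⟪w, x * quatK⟫_ℝ = w := by
  have h : (x : ℍ[ℝ]) * star (x : ℍ[ℝ]) = 1 := by
    rw [Quaternion.self_mul_star, Quaternion.normSq_eq_norm_mul_self, norm_coe_S3]
    simp
  obtain ⟨u, rfl⟩ : ∃ u, w = x * u := ⟨star (x : ℍ[ℝ]) * w, by rw [← mul_assoc, h, one_mul]⟩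
  have hu : u.re = 0 := by
    have := inner_mul_mul x 1 u
    rw [mul_one, hw, inner_eq_sum] at this
    simpa using this.symm
  congr 1
  simp only [inner_mul_mul]
  ext <;> simp [inner_eq_sum, hu]

theorem inclDeriv_fieldA (x : S3) : inclDeriv x (fieldA x) = x * quatI :=
  inclDeriv_leftInvField _ _ x

theorem inclDeriv_fieldB (x : S3) : inclDeriv x (fieldB x) = x * quatJ :=
  inclDeriv_leftInvField _ _ x

theorem inclDeriv_fieldC (x : S3) : inclDeriv x (fieldC x) = x * quatK :=
  inclDeriv_leftInvField _ _ x

theorem inclDeriv_combo (f g h : S3 → ℝ) (x : S3) :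
    inclDeriv x (combo f g h x) = x * imVec (f x) (g x) (h x) := by
  simp only [combo, map_add, map_smul, inclDeriv_fieldA, inclDeriv_fieldB, inclDeriv_fieldC,
    imVec, mul_add, mul_smul_comm]

theorem dirDeriv_eq {V : VectorField} {f : S3 → ℝ} (hf : IsSmooth f) (x : S3) :
    dirDeriv V f x = fderiv ℝ (fun q => f (nrm q)) x (inclDeriv x (V x)) :=
  mvfderiv_eq_fderiv hf x _

theorem contactForm_apply (x : S3) (v : T x) :
    contactForm x v = ⟪(x : ℍ[ℝ]) * quatI, inclDeriv x v⟫_ℝ := by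
  rw [← inclDeriv_fieldA]
  rfl

theorem combo_injective {f g h f' g' h' : S3 → ℝ} (e : combo f g h = combo f' g' h') :
    f = f' ∧ g = g' ∧ h = h' := by
  have key : ∀ x, imVec (f x) (g x) (h x) = imVec (f' x) (g' x) (h' x) := fun x => by
    have := congrArg (fun X : VectorField => inclDeriv x (X x)) e
    simp only [inclDeriv_combo] at this
    exact mul_left_cancel₀ (coe_S3_ne_zero x) this
  refine ⟨funext fun x => ?_, funext fun x => ?_, funext fun x => ?_⟩
  · simpa using congrArg (·.imI) (key x)
  · simpa using congrArg (·.imJ) (key x)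
  · simpa using congrArg (·.imK) (key x)

/-- The derivative of the quaternion-valued map of the vector field `f A + g B + h C`. -/
theorem hasFDerivAt_mul_imVec {f g h : S3 → ℝ} (hf : IsSmooth f) (hg : IsSmooth g)
    (hh : IsSmooth h) (x : S3) {w : ℍ[ℝ]} (hw : ⟪(x : ℍ[ℝ]), w⟫_ℝ = 0) :
    ∃ L : ℍ[ℝ] →L[ℝ] ℍ[ℝ], HasFDerivAt
      (fun q => (nrm q : ℍ[ℝ]) * imVec (f (nrm q)) (g (nrm q)) (h (nrm q))) L x ∧
      L w = w * imVec (f x) (g x) (h x) + x * imVec (fderiv ℝ (fun q => f (nrm q)) x w)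
        (fderiv ℝ (fun q => g (nrm q)) x w) (fderiv ℝ (fun q => h (nrm q)) x w) := by
  have d : ∀ {φ : S3 → ℝ}, IsSmooth φ → HasFDerivAt (fun q => φ (nrm q))
      (fderiv ℝ (fun q => φ (nrm q)) x) (x : ℍ[ℝ]) := fun hφ =>
    ((contDiffAt_comp_nrm hφ (coe_S3_ne_zero x)).differentiableAt (by simp)).hasFDerivAt
  have dn : HasFDerivAt (fun q => (nrm q : ℍ[ℝ])) (fderiv ℝ (fun q => (nrm q : ℍ[ℝ])) x)
      (x : ℍ[ℝ]) :=
    ((contDiffAt_comp_nrm contMDiff_val (coe_S3_ne_zero x)).differentiableAt (by simp)).hasFDerivAt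
  have dv := (((d hf).smul_const quatI).add ((d hg).smul_const quatJ)).add
    ((d hh).smul_const quatK)
  refine ⟨_, dn.mul' dv, ?_⟩
  simp [fderiv_nrm hw, imVec, mul_add, add_comm]

/-! ### Necessary conditions on the initial velocity -/

/-- Symmetry of mixed partial derivatives. -/
theorem hasDerivAt_fderiv_snd {E E' : Type*} [NormedAddCommGroup E] [NormedSpace ℝ E]
    [NormedAddCommGroup E'] [NormedSpace ℝ E'] {Φ : ℝ × E → E'} {t : ℝ} {x : E}
    (hΦ : ContDiffAt ℝ ∞ Φ (t, x)) (w : E) :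
    HasDerivAt (fun s => fderiv ℝ Φ (s, x) (0, w))
      (fderiv ℝ (fun q => fderiv ℝ Φ (t, q) (1, 0)) x w) t := by
  have h1 : HasFDerivAt (fderiv ℝ Φ) (fderiv ℝ (fderiv ℝ Φ) (t, x)) (t, x) :=
    ((hΦ.fderiv_right (m := 1) (by norm_cast)).differentiableAt (by simp)).hasFDerivAt
  have hsymm : IsSymmSndFDerivAt ℝ Φ (t, x) :=
    hΦ.isSymmSndFDerivAt (by rw [minSmoothness_of_isRCLikeNormedField]; norm_cast)
  have hline : HasDerivAt (fun s : ℝ => (s, x)) ((1 : ℝ), (0 : E)) t :=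
    (hasDerivAt_id t).prodMk (hasDerivAt_const t _)
  have h2 : HasDerivAt (fun s => fderiv ℝ Φ (s, x)) (fderiv ℝ (fderiv ℝ Φ) (t, x) (1, 0)) t :=
    h1.comp_hasDerivAt t hline
  have h3 : HasFDerivAt (fun q => fderiv ℝ Φ (t, q))
      ((fderiv ℝ (fderiv ℝ Φ) (t, x)).comp (ContinuousLinearMap.inr ℝ ℝ E)) x :=
    h1.comp x (hasFDerivAt_prodMk_right t x)
  have h4 := ((ContinuousLinearMap.apply ℝ E' ((1 : ℝ), (0 : E))).hasFDerivAt.comp x h3).fderiv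
  have h5 : fderiv ℝ (fun q => fderiv ℝ Φ (t, q) (1, 0)) x w =
      fderiv ℝ (fderiv ℝ Φ) (t, x) (1, 0) (0, w) :=
    (congrArg (fun L : E →L[ℝ] E' => L w) h4).trans (hsymm.eq (0, w) (1, 0))
  rw [h5]
  exact (ContinuousLinearMap.apply ℝ E' ((0 : ℝ), w)).hasFDerivAt.comp_hasDerivAt t h2

/-- The hypotheses on a smooth curve of diffeomorphisms starting at the identity with a given
initial velocity. -/
structure IsCurve (F : ℝ → Diff) (ε : ℝ) (X : VectorField) : Prop where
  pos : 0 < ε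
  smooth : ContMDiffOn (𝓘(ℝ, ℝ).prod (𝓡 3)) (𝓡 3) ∞ (fun p : ℝ × S3 => F p.1 p.2)
    (Ioo (-ε) ε ×ˢ univ)
  start : ∀ x, F 0 x = x
  velocity : ∀ x, HasDerivAt (fun t : ℝ => (F t x : ℍ[ℝ])) (inclDeriv x (X x)) 0

namespace IsCurve

variable {F : ℝ → Diff} {ε : ℝ} {X : VectorField}

theorem contDiffAt (hF : IsCurve F ε X) {t : ℝ} (ht : t ∈ Ioo (-ε) ε) {q : ℍ[ℝ]} (hq : q ≠ 0) :
    ContDiffAt ℝ ∞ (fun p : ℝ × ℍ[ℝ] => (F p.1 (nrm p.2) : ℍ[ℝ])) (t, q) :=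
  contDiffAt_family isOpen_Ioo (F := fun t => F t) hF.smooth ht hq

theorem zero_mem (hF : IsCurve F ε X) : (0 : ℝ) ∈ Ioo (-ε) ε := ⟨neg_lt_zero.2 hF.pos, hF.pos⟩

theorem fderiv_time (hF : IsCurve F ε X) {q : ℍ[ℝ]} (hq : q ≠ 0) :
    fderiv ℝ (fun p : ℝ × ℍ[ℝ] => (F p.1 (nrm p.2) : ℍ[ℝ])) (0, q) (1, 0) =
      inclDeriv (nrm q) (X (nrm q)) := by
  have h1 := ((hF.contDiffAt hF.zero_mem hq).differentiableAt (by simp)).hasFDerivAt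
  have h2 : HasDerivAt (fun t : ℝ => (t, q)) ((1 : ℝ), (0 : ℍ[ℝ])) 0 :=
    (hasDerivAt_id 0).prodMk (hasDerivAt_const 0 q)
  have h3 := h1.comp_hasDerivAt 0 h2
  exact h3.unique (hF.velocity (nrm q))

/-- The coefficients are the inner products of `X` with the frame. They are smooth because `X` is
the time derivative of a map jointly smooth in `t` and `x`. -/
theorem exists_eq_combo (hF : IsCurve F ε X) :
    ∃ f g h, IsSmooth f ∧ IsSmooth g ∧ IsSmooth h ∧ X = combo f g h := by
  have hs : ∀ a : ℍ[ℝ], IsSmooth (fun x => ⟪inclDeriv x (X x), x * a⟫_ℝ) := fun a => by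
    have h1 : ∀ q ≠ (0 : ℍ[ℝ]), ContDiffAt ℝ ∞ (fun q : ℍ[ℝ] =>
        ⟪fderiv ℝ (fun p : ℝ × ℍ[ℝ] => (F p.1 (nrm p.2) : ℍ[ℝ])) (0, q) (1, 0), q * a⟫_ℝ) q := by
      intro q hq
      have h2 : ContDiffAt ℝ ∞ (fderiv ℝ fun p : ℝ × ℍ[ℝ] => (F p.1 (nrm p.2) : ℍ[ℝ])) (0, q) :=
        (hF.contDiffAt hF.zero_mem hq).fderiv_right (by simp)
      have h3 : ContDiffAt ℝ ∞ (fun q : ℍ[ℝ] =>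
          fderiv ℝ (fun p : ℝ × ℍ[ℝ] => (F p.1 (nrm p.2) : ℍ[ℝ])) (0, q)) q :=
        h2.comp q (contDiffAt_const.prodMk contDiffAt_id)
      exact (h3.clm_apply contDiffAt_const).inner ℝ (contDiffAt_id.mul contDiffAt_const)
    refine (contMDiff_comp_val h1).congr fun x => ?_
    rw [hF.fderiv_time (coe_S3_ne_zero x), nrm_coe]
  refine ⟨_, _, _, hs quatI, hs quatJ, hs quatK, funext fun x => inclDeriv_injective x ?_⟩
  rw [inclDeriv_combo, mul_imVec_inner (inner_inclDeriv x (X x))]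

/-- By the product rule, the first factor contributes the derivative of `X = x u` along `V`, which
is `x (a u + V u)` after exchanging the time and space derivatives. The second contributes `X b = x
u b`. The common left factor `x` drops out by isometry. -/
theorem hasDerivAt_pairing {f g h : S3 → ℝ} (hf : IsSmooth f) (hg : IsSmooth g)
    (hh : IsSmooth h) (hF : IsCurve F ε (combo f g h)) (x : S3) (V : VectorField) {a : ℍ[ℝ]}
    (hV : inclDeriv x (V x) = x * a) (b : ℍ[ℝ]) :
    HasDerivAt (fun t => ⟪inclDeriv (F t x) (diffDeriv (F t) x (V x)), F t x * b⟫_ℝ)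
      (⟪a * imVec (f x) (g x) (h x) + imVec (dirDeriv V f x) (dirDeriv V g x) (dirDeriv V h x), b⟫_ℝ
        + ⟪a, imVec (f x) (g x) (h x) * b⟫_ℝ) 0 := by
  have hx := coe_S3_ne_zero x
  have hw : ⟪(x : ℍ[ℝ]), x * a⟫_ℝ = 0 := hV ▸ inner_inclDeriv x (V x)
  have h2 := hasDerivAt_fderiv_snd (hF.contDiffAt hF.zero_mem hx) ((x : ℍ[ℝ]) * a)
  obtain ⟨L, hL, hLw⟩ := hasFDerivAt_mul_imVec hf hg hh x hw
  have h4 := (hL.congr_of_eventuallyEq (by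
    filter_upwards [isOpen_compl_singleton.mem_nhds hx] with q hq
    exact (hF.fderiv_time hq).trans (inclDeriv_combo f g h (nrm q)))).fderiv
  rw [h4, hLw, mul_assoc, ← mul_add, ← hV, ← dirDeriv_eq hf, ← dirDeriv_eq hg, ← dirDeriv_eq hh]
    at h2
  have h6 := (hF.velocity x).mul_const b
  rw [inclDeriv_combo] at h6
  have e : (fun t => inclDeriv (F t x) (diffDeriv (F t) x (V x))) =ᶠ[𝓝 0] fun t =>
      fderiv ℝ (fun p : ℝ × ℍ[ℝ] => (F p.1 (nrm p.2) : ℍ[ℝ])) (t, x) (0, inclDeriv x (V x)) := by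
    filter_upwards [isOpen_Ioo.mem_nhds hF.zero_mem] with t ht
    rw [inclDeriv_diffDeriv]
    have e := (((hF.contDiffAt ht hx).differentiableAt (by simp)).hasFDerivAt.comp (x : ℍ[ℝ])
      (hasFDerivAt_prodMk_right t (x : ℍ[ℝ]))).fderiv
    exact congrArg (fun L => L (inclDeriv x (V x))) e
  have h0 : inclDeriv (F 0 x) (diffDeriv (F 0) x (V x)) = x * a := by
    rw [inclDeriv_diffDeriv, hV]
    simp only [hF.start]
    exact fderiv_nrm hw
  have h7 := HasDerivAt.inner ℝ (h2.congr_of_eventuallyEq e) h6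
  rw [h0, hF.start, mul_assoc, inner_mul_mul, inner_mul_mul, add_comm] at h7
  exact h7

theorem pairing_eq_zero {f g h : S3 → ℝ} (hf : IsSmooth f) (hg : IsSmooth g)
    (hh : IsSmooth h) (hF : IsCurve F ε (combo f g h)) (x : S3) (V : VectorField) {a : ℍ[ℝ]}
    (hV : inclDeriv x (V x) = x * a) (b : ℍ[ℝ]) (c : ℝ)
    (hc : ∀ t ∈ Ioo (-ε) ε, ⟪inclDeriv (F t x) (diffDeriv (F t) x (V x)), F t x * b⟫_ℝ = c) :
    ⟪a * imVec (f x) (g x) (h x) + imVec (dirDeriv V f x) (dirDeriv V g x) (dirDeriv V h x), b⟫_ℝ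
      + ⟪a, imVec (f x) (g x) (h x) * b⟫_ℝ = 0 := by
  refine (hasDerivAt_pairing hf hg hh hF x V hV b).unique
    ((hasDerivAt_const (0 : ℝ) c).congr_of_eventuallyEq ?_)
  filter_upwards [isOpen_Ioo.mem_nhds hF.zero_mem] with t ht using hc t ht

/-- `dF_t(A)` is a multiple of `A`, hence orthogonal to `B` and `C` at `F_t(x)`: take `a = i` and `b
= j, k`. -/
theorem hopf_conditions {f g h : S3 → ℝ} (hf : IsSmooth f) (hg : IsSmooth g)
    (hh : IsSmooth h) (hF : IsCurve F ε (combo f g h)) (hA : ∀ t ∈ Ioo (-ε) ε, F t ∈ AutHopf)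
    (x : S3) : g x = -(1 / 2) * dirDeriv fieldA h x ∧ h x = (1 / 2) * dirDeriv fieldA g x := by
  have hc : ∀ b : ℍ[ℝ], b.imI = 0 → ∀ t ∈ Ioo (-ε) ε,
      ⟪inclDeriv (F t x) (diffDeriv (F t) x (fieldA x)), F t x * b⟫_ℝ = 0 := by
    intro b hb t ht
    obtain ⟨-, c, -, h1⟩ := hA t ht x
    rw [h1, map_smul, inclDeriv_fieldA, real_inner_smul_left, inner_mul_mul]
    simp [inner_eq_sum, hb]
  have h1 := pairing_eq_zero hf hg hh hF x fieldA (inclDeriv_fieldA x) quatJ 0 (hc _ rfl)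
  have h2 := pairing_eq_zero hf hg hh hF x fieldA (inclDeriv_fieldA x) quatK 0 (hc _ rfl)
  simp [inner_eq_sum] at h1 h2
  constructor <;> linarith

/-- `B` and `C` span the contact planes, so their images stay orthogonal to `A`: take `a = j, k` and
`b = i`. -/
theorem contact_conditions {f g h : S3 → ℝ} (hf : IsSmooth f) (hg : IsSmooth g)
    (hh : IsSmooth h) (hF : IsCurve F ε (combo f g h))
    (hA : ∀ t ∈ Ioo (-ε) ε, ∀ x v, contactForm x v = 0 →
      contactForm (F t x) (diffDeriv (F t) x v) = 0) (x : S3) :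
    g x = (1 / 2) * dirDeriv fieldC f x ∧ h x = -(1 / 2) * dirDeriv fieldB f x := by
  have hc : ∀ V : VectorField, contactForm x (V x) = 0 → ∀ t ∈ Ioo (-ε) ε,
      ⟪inclDeriv (F t x) (diffDeriv (F t) x (V x)), F t x * quatI⟫_ℝ = 0 := by
    intro V hV t ht
    rw [real_inner_comm, ← contactForm_apply]
    exact hA t ht x _ hV
  have h1 := pairing_eq_zero hf hg hh hF x fieldB (inclDeriv_fieldB x) quatI 0 (hc _ (by
    rw [contactForm_apply, inclDeriv_fieldB, inner_mul_mul]
    simp [inner_eq_sum]))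
  have h2 := pairing_eq_zero hf hg hh hF x fieldC (inclDeriv_fieldC x) quatI 0 (hc _ (by
    rw [contactForm_apply, inclDeriv_fieldC, inner_mul_mul]
    simp [inner_eq_sum]))
  simp [inner_eq_sum] at h1 h2
  constructor <;> linarith

theorem strict_condition {f g h : S3 → ℝ} (hf : IsSmooth f) (hg : IsSmooth g)
    (hh : IsSmooth h) (hF : IsCurve F ε (combo f g h))
    (hA : ∀ t ∈ Ioo (-ε) ε, F t ∈ AutContactStrict) (x : S3) : dirDeriv fieldA f x = 0 := by
  have h1 := pairing_eq_zero hf hg hh hF x fieldA (inclDeriv_fieldA x) quatI 1 (by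
    intro t ht
    rw [real_inner_comm, ← contactForm_apply, hA t ht x, contactForm_apply, inclDeriv_fieldA,
      inner_mul_mul, inner_eq_sum]
    simp)
  simp [inner_eq_sum] at h1
  simpa using h1

end IsCurve

/-! ### Smoothness of directional derivatives, and velocities of projected curves -/

theorem mem_tangentAtId_iff {G : Set Diff} {X : VectorField} :
    X ∈ tangentAtId G ↔ ∃ ε F, IsCurve F ε X ∧ ∀ t ∈ Ioo (-ε) ε, F t ∈ G :=
  ⟨fun ⟨ε, h1, F, h2, h3, h4, h5⟩ => ⟨ε, F, ⟨h1, h2, h4, h5⟩, h3⟩,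
    fun ⟨ε, F, ⟨h1, h2, h4, h5⟩, h3⟩ => ⟨ε, h1, F, h2, h3, h4, h5⟩⟩

theorem isSmooth_dirDeriv {V : VectorField} {a : ℍ[ℝ]} (hV : ∀ x, inclDeriv x (V x) = x * a)
    {f : S3 → ℝ} (hf : IsSmooth f) : IsSmooth (dirDeriv V f) := by
  have h1 : ∀ q ≠ (0 : ℍ[ℝ]), ContDiffAt ℝ ∞
      (fun q : ℍ[ℝ] => fderiv ℝ (fun q => f (nrm q)) q (q * a)) q := fun q hq =>
    ((contDiffAt_comp_nrm hf hq).fderiv_right (by simp)).clm_apply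
      (contDiffAt_id.mul contDiffAt_const)
  refine (contMDiff_comp_val h1).congr fun x => ?_
  rw [dirDeriv_eq hf, hV]

theorem fderiv_comp_nrm_self {E : Type*} [NormedAddCommGroup E] [NormedSpace ℝ E] {f : S3 → E}
    (hf : ContMDiff (𝓡 3) 𝓘(ℝ, E) ∞ f) (x : S3) :
    fderiv ℝ (fun q => f (nrm q)) (x : ℍ[ℝ]) x = 0 := by
  have h1 : HasDerivAt (fun s : ℝ => s • (x : ℍ[ℝ])) x 1 := by
    simpa using (hasDerivAt_id (1 : ℝ)).smul_const (x : ℍ[ℝ])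
  have h2 : HasFDerivAt (fun q => f (nrm q)) (fderiv ℝ (fun q => f (nrm q)) (x : ℍ[ℝ]))
      ((1 : ℝ) • (x : ℍ[ℝ])) := by
    rw [one_smul]
    exact ((contDiffAt_comp_nrm hf (coe_S3_ne_zero x)).differentiableAt (by simp)).hasFDerivAt
  refine (h2.comp_hasDerivAt 1 h1).unique
    ((hasDerivAt_const (1 : ℝ) (f x)).congr_of_eventuallyEq ?_)
  filter_upwards [lt_mem_nhds one_pos] with s hs
  simp [nrm_smul hs]

/-- The velocity of the radial projection of a curve through a point of the sphere. -/
theorem hasDerivAt_nrm_comp {c : ℝ → ℍ[ℝ]} {x : S3} {w : ℍ[ℝ]} {t r : ℝ} (h0 : c t = x)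
    (hw : ⟪(x : ℍ[ℝ]), w⟫_ℝ = 0) (hc : HasDerivAt c (r • (x : ℍ[ℝ]) + w) t) :
    HasDerivAt (fun s => (nrm (c s) : ℍ[ℝ])) w t := by
  have h2 : HasFDerivAt (fun q => (nrm q : ℍ[ℝ])) (fderiv ℝ (fun q => (nrm q : ℍ[ℝ])) x) (c t) := by
    rw [h0]
    exact ((contDiffAt_comp_nrm contMDiff_val
      (coe_S3_ne_zero x)).differentiableAt (by simp)).hasFDerivAt
  have h3 := h2.comp_hasDerivAt t hc
  rw [map_add, map_smul, fderiv_comp_nrm_self contMDiff_val, smul_zero, zero_add, fderiv_nrm hw] at h3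
  exact h3

theorem inner_self_mul {x : S3} {p : ℍ[ℝ]} (hp : p.re = 0) : ⟪(x : ℍ[ℝ]), x * p⟫_ℝ = 0 := by
  have := inner_mul_mul x 1 p
  rw [mul_one] at this
  rw [this, inner_eq_sum]
  simp [hp]

/-! ### The Hopf flow and its orbits -/

/-- The unit quaternion `cos θ + i sin θ`. -/
def rot (θ : ℝ) : ℍ[ℝ] := Real.cos θ • (1 : ℍ[ℝ]) + Real.sin θ • quatI

@[simp] theorem re_rot (θ : ℝ) : (rot θ).re = Real.cos θ := by simp [rot]

@[simp] theorem imI_rot (θ : ℝ) : (rot θ).imI = Real.sin θ := by simp [rot]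

@[simp] theorem imJ_rot (θ : ℝ) : (rot θ).imJ = 0 := by simp [rot]

@[simp] theorem imK_rot (θ : ℝ) : (rot θ).imK = 0 := by simp [rot]

@[simp] theorem rot_zero : rot 0 = 1 := by simp [rot]

theorem rot_mul_rot (θ φ : ℝ) : rot θ * rot φ = rot (θ + φ) := by
  ext <;> simp [Real.cos_add, Real.sin_add]
  ring

theorem norm_rot (θ : ℝ) : ‖rot θ‖ = 1 := by
  have h : ‖rot θ‖ * ‖rot θ‖ = 1 := by
    rw [← Quaternion.normSq_eq_norm_mul_self, Quaternion.normSq_def']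
    simp
  nlinarith [norm_nonneg (rot θ)]

theorem contDiff_rot : ContDiff ℝ ∞ rot :=
  (Real.contDiff_cos.smul contDiff_const).add (Real.contDiff_sin.smul contDiff_const)

theorem hasDerivAt_rot (θ : ℝ) : HasDerivAt rot (rot θ * quatI) θ := by
  have h := ((Real.hasDerivAt_cos θ).smul_const (1 : ℍ[ℝ])).add
    ((Real.hasDerivAt_sin θ).smul_const quatI)
  refine h.congr_deriv ?_
  ext <;> simp

/-- The Hopf flow. -/
def rotS (x : S3) (θ : ℝ) : S3 := ⟨x * rot θ, by simp [norm_rot]⟩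

@[simp] theorem coe_rotS (x : S3) (θ : ℝ) : (rotS x θ : ℍ[ℝ]) = x * rot θ := rfl

theorem rotS_rotS (x : S3) (θ φ : ℝ) : rotS (rotS x θ) φ = rotS x (θ + φ) := by
  ext1
  simp [mul_assoc, rot_mul_rot]

@[simp] theorem rotS_zero (x : S3) : rotS x 0 = x := by
  ext1
  simp

/-- Both points have norm one, so the complex factor has norm one and is `rot` of its argument. -/
theorem mem_hopfFiber_iff {x y : S3} : y ∈ hopfFiber x ↔ ∃ θ, y = rotS x θ := by
  constructor
  · rintro ⟨z, hz⟩
    have h1 : ‖(z : ℍ[ℝ])‖ = 1 := by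
      have := congrArg norm hz
      rwa [norm_mul, norm_coe_S3, norm_coe_S3, one_mul, eq_comm] at this
    have h2 : ‖z‖ = 1 := by
      have h3 : ‖z‖ * ‖z‖ = 1 := by
        rw [Complex.norm_mul_self_eq_normSq, Complex.normSq_apply]
        have := Quaternion.normSq_eq_norm_mul_self (z : ℍ[ℝ])
        rw [h1, Quaternion.normSq_def'] at this
        simp at this
        nlinarith
      nlinarith [norm_nonneg z]
    refine ⟨z.arg, Subtype.ext ?_⟩
    rw [hz, coe_rotS]
    congr 1
    have h3 := Complex.norm_mul_cos_arg z
    have h4 := Complex.norm_mul_sin_arg z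
    rw [h2, one_mul] at h3 h4
    ext <;> simp [h3, h4]
  · rintro ⟨θ, rfl⟩
    refine ⟨⟨Real.cos θ, Real.sin θ⟩, ?_⟩
    rw [coe_rotS]
    congr 1
    ext <;> simp

theorem hasDerivAt_mul_rot (x : ℍ[ℝ]) (θ : ℝ) :
    HasDerivAt (fun θ => x * rot θ) (x * rot θ * quatI) θ := by
  rw [mul_assoc]
  exact (hasDerivAt_rot θ).const_mul x

theorem hasDerivAt_comp_rotS {f : S3 → ℝ} (hf : IsSmooth f) (x : S3) (θ : ℝ) :
    HasDerivAt (fun θ => f (rotS x θ)) (dirDeriv fieldA f (rotS x θ)) θ := by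
  rw [dirDeriv_eq hf, inclDeriv_fieldA]
  have h1 : HasFDerivAt (fun q => f (nrm q)) (fderiv ℝ (fun q => f (nrm q)) (rotS x θ))
      ((x : ℍ[ℝ]) * rot θ) :=
    ((contDiffAt_comp_nrm hf (coe_S3_ne_zero (rotS x θ))).differentiableAt (by simp)).hasFDerivAt
  have h2 := h1.comp_hasDerivAt θ (hasDerivAt_mul_rot x θ)
  refine h2.congr_of_eventuallyEq (Filter.Eventually.of_forall fun φ => ?_)
  change _ = f (nrm (rotS x φ))
  rw [nrm_coe]

/-- A function with vanishing derivative along the Hopf field is constant along the fibers. -/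
theorem eq_of_mem_hopfFiber {f : S3 → ℝ} (hf : IsSmooth f) (h : ∀ x, dirDeriv fieldA f x = 0)
    {x y : S3} (hy : y ∈ hopfFiber x) : f y = f x := by
  obtain ⟨θ, rfl⟩ := mem_hopfFiber_iff.1 hy
  have h1 : ∀ θ, HasDerivAt (fun θ => f (rotS x θ)) 0 θ := fun θ => by
    have := hasDerivAt_comp_rotS hf x θ
    rwa [h] at this
  have := is_const_of_deriv_eq_zero (fun θ => (h1 θ).differentiableAt) (fun θ => (h1 θ).deriv) θ 0
  simpa using this

/-! ### Curves of automorphisms of the Hopf fibration -/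

section Hopf

variable {f g h : S3 → ℝ}

/-- The horizontal part `g j + h k` is equivariant along the Hopf fibers. -/
theorem rot_mul_imVec (hg : IsSmooth g) (hh : IsSmooth h)
    (h1 : ∀ x, g x = -(1 / 2) * dirDeriv fieldA h x)
    (h2 : ∀ x, h x = (1 / 2) * dirDeriv fieldA g x) (x : S3) (θ : ℝ) :
    rot θ * imVec 0 (g (rotS x θ)) (h (rotS x θ)) = imVec 0 (g x) (h x) * rot θ := by
  have dg : ∀ θ, HasDerivAt (fun θ => g (rotS x θ)) (2 * h (rotS x θ)) θ := fun θ => by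
    convert hasDerivAt_comp_rotS hg x θ using 1
    rw [h2]; ring
  have dh : ∀ θ, HasDerivAt (fun θ => h (rotS x θ)) (-2 * g (rotS x θ)) θ := fun θ => by
    convert hasDerivAt_comp_rotS hh x θ using 1
    rw [h1]; ring
  have dc : ∀ θ : ℝ, HasDerivAt (fun θ => Real.cos (2 * θ)) (-(2 * Real.sin (2 * θ))) θ := fun θ => by
    simpa [mul_comm] using ((hasDerivAt_id θ).const_mul 2).cos
  have ds : ∀ θ : ℝ, HasDerivAt (fun θ => Real.sin (2 * θ)) (2 * Real.cos (2 * θ)) θ := fun θ => by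
    simpa [mul_comm] using ((hasDerivAt_id θ).const_mul 2).sin
  -- Along a fiber `g' = 2 h` and `h' = -2 g`, so turning `(g, h)` by the angle `2θ` gives a vector
  -- constant in `θ`. Conjugation by `rot θ` acts on the `j, k` plane through the same double angle.
  have e1 : ∀ θ, HasDerivAt (fun θ => Real.cos (2 * θ) * g (rotS x θ)
      - Real.sin (2 * θ) * h (rotS x θ)) 0 θ := fun θ => by
    refine (((dc θ).mul (dg θ)).sub ((ds θ).mul (dh θ))).congr_deriv ?_
    ring
  have e2 : ∀ θ, HasDerivAt (fun θ => Real.sin (2 * θ) * g (rotS x θ)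
      + Real.cos (2 * θ) * h (rotS x θ)) 0 θ := fun θ => by
    refine (((ds θ).mul (dg θ)).add ((dc θ).mul (dh θ))).congr_deriv ?_
    ring
  have c1 := is_const_of_deriv_eq_zero (fun θ => (e1 θ).differentiableAt) (fun θ => (e1 θ).deriv) θ 0
  have c2 := is_const_of_deriv_eq_zero (fun θ => (e2 θ).differentiableAt) (fun θ => (e2 θ).deriv) θ 0
  simp only [mul_zero, Real.cos_zero, Real.sin_zero, rotS_zero, one_mul, zero_mul, sub_zero,
    zero_add] at c1 c2
  rw [← c1, ← c2, Real.cos_two_mul, Real.sin_two_mul]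
  have hcs := Real.sin_sq_add_cos_sq θ
  set C := Real.cos θ with hC
  set S := Real.sin θ with hS
  set G := g (rotS x θ)
  set K := h (rotS x θ)
  have hS2 : S ^ 2 = 1 - C ^ 2 := by linarith
  ext <;> simp [← hC, ← hS]
  · linear_combination (-2 * C * G) * hS2
  · linear_combination (-2 * C * K) * hS2

/-- The family `q ↦ q (1 + t (g j + h k)) exp(t f i)`. -/
def hopfFamily (f g h : S3 → ℝ) (t : ℝ) (q : ℍ[ℝ]) : ℍ[ℝ] :=
  q * (1 + t • imVec 0 (g (nrm q)) (h (nrm q))) * rot (t * f (nrm q))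

theorem contDiffAt_imVec {E : Type*} [NormedAddCommGroup E] [NormedSpace ℝ E] {a b c : E → ℝ}
    {x : E} (ha : ContDiffAt ℝ ∞ a x) (hb : ContDiffAt ℝ ∞ b x) (hc : ContDiffAt ℝ ∞ c x) :
    ContDiffAt ℝ ∞ (fun y => imVec (a y) (b y) (c y)) x :=
  ((ha.smul contDiffAt_const).add (hb.smul contDiffAt_const)).add (hc.smul contDiffAt_const)

theorem isHomFamily_hopfFamily (hf : IsSmooth f) (hg : IsSmooth g) (hh : IsSmooth h) :
    IsHomFamily (hopfFamily f g h) where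
  smooth t q hq := by
    have d : ∀ {φ : S3 → ℝ}, IsSmooth φ →
        ContDiffAt ℝ ∞ (fun p : ℝ × ℍ[ℝ] => φ (nrm p.2)) (t, q) := fun {φ} hφ =>
      ContDiffAt.comp (g := fun q => φ (nrm q)) (t, q) (contDiffAt_comp_nrm hφ hq) contDiffAt_snd
    have h1 : ContDiffAt ℝ ∞ (fun p : ℝ × ℍ[ℝ] => rot (p.1 * f (nrm p.2))) (t, q) :=
      contDiff_rot.contDiffAt.comp (t, q) (contDiffAt_fst.mul (d hf))
    exact (contDiffAt_snd.mul (contDiffAt_const.add (contDiffAt_fst.smul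
      (contDiffAt_imVec contDiffAt_const (d hg) (d hh))))).mul h1
  hom t r hr q := by simp [hopfFamily, nrm_smul hr]
  id_zero q _ := by simp [hopfFamily]

theorem nrm_mul_rot (q : ℍ[ℝ]) (hq : q ≠ 0) (θ : ℝ) : nrm (q * rot θ) = rotS (nrm q) θ := by
  have h : q * rot θ = ‖q‖ • (rotS (nrm q) θ : ℍ[ℝ]) := by
    rw [coe_rotS, ← smul_mul_assoc, norm_smul_nrm]
  rw [h, nrm_smul (norm_pos_iff.2 hq), nrm_coe]

theorem hopfFamily_eq (f g h : S3 → ℝ) (t : ℝ) (x : S3) :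
    hopfFamily f g h t x = hopfFamily (fun _ => 0) g h t x * rot (t * f x) := by
  simp [hopfFamily]

/-- Equivariance of `g j + h k` lets `rot θ` pass from the left of the factor `1 + t (g j + h k)` to
its right. -/
theorem hopfFamily_rotS (hg : IsSmooth g) (hh : IsSmooth h)
    (h1 : ∀ x, g x = -(1 / 2) * dirDeriv fieldA h x)
    (h2 : ∀ x, h x = (1 / 2) * dirDeriv fieldA g x) (t : ℝ) (x : S3) (θ : ℝ) :
    hopfFamily (fun _ => 0) g h t (rotS x θ) = hopfFamily (fun _ => 0) g h t x * rot θ := by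
  simp only [hopfFamily, nrm_coe, mul_zero, rot_zero, mul_one]
  rw [coe_rotS, mul_assoc, mul_assoc, mul_add, mul_smul_comm, rot_mul_imVec hg hh h1 h2]
  simp [add_mul]

theorem hasDerivAt_hopfFamily (f g h : S3 → ℝ) (x : S3) :
    HasDerivAt (fun t => hopfFamily f g h t x) (x * imVec (f x) (g x) (h x)) 0 := by
  have e1 : HasDerivAt (fun t : ℝ => (x : ℍ[ℝ]) * (1 + t • imVec 0 (g x) (h x)))
      (x * imVec 0 (g x) (h x)) 0 := by
    simpa using (((hasDerivAt_id (0 : ℝ)).smul_const (imVec 0 (g x) (h x))).const_add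
      (1 : ℍ[ℝ])).const_mul (x : ℍ[ℝ])
  have e2 : HasDerivAt (fun t : ℝ => rot (t * f x)) (f x • quatI) 0 := by
    have e3 : HasDerivAt (fun t : ℝ => t * f x) (f x) 0 := by
      simpa using (hasDerivAt_id (0 : ℝ)).mul_const (f x)
    have e4 : HasDerivAt rot quatI ((0 : ℝ) * f x) := by
      simpa using hasDerivAt_rot 0
    exact e4.scomp (0 : ℝ) e3
  have e5 := e1.mul e2
  simp only [zero_mul, rot_zero, mul_one, zero_smul, add_zero] at e5
  have e6 : (fun t => hopfFamily f g h t x) =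
      (fun t : ℝ => (x : ℍ[ℝ]) * (1 + t • imVec 0 (g x) (h x))) * fun t : ℝ => rot (t * f x) := by
    funext t
    simp only [hopfFamily, nrm_coe, Pi.mul_apply]
  rw [e6]
  refine e5.congr_deriv ?_
  rw [← mul_add]
  congr 1
  ext <;> simp

/-- The diffeomorphism `Q t` is `G t`, which commutes with the Hopf flow, followed by the rotation
by `t f` within fibers. On a fiber it therefore reads `θ ↦ θ + t f(rotS x θ) - t f x`. -/
theorem mem_tangentAtId_autHopf (hf : IsSmooth f) (hg : IsSmooth g) (hh : IsSmooth h)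
    (h1 : ∀ x, g x = -(1 / 2) * dirDeriv fieldA h x)
    (h2 : ∀ x, h x = (1 / 2) * dirDeriv fieldA g x) :
    combo f g h ∈ tangentAtId AutHopf := by
  obtain ⟨ε₁, hε₁, Q, hQ, hQs, -⟩ := (isHomFamily_hopfFamily hf hg hh).exists_diffeo
  obtain ⟨ε₂, hε₂, G, hG, -, -⟩ :=
    (isHomFamily_hopfFamily (f := fun _ => 0) contMDiff_const hg hh).exists_diffeo
  obtain ⟨M, hM⟩ : ∃ M, ∀ x, ‖dirDeriv fieldA f x‖ ≤ M := by
    obtain ⟨M, hM⟩ := isCompact_univ.exists_bound_of_continuousOn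
      (isSmooth_dirDeriv inclDeriv_fieldA hf).continuous.continuousOn
    exact ⟨M, fun x => hM x (mem_univ x)⟩
  -- The bound `|t| < (|M| + 1)⁻¹` ensures `1 + t Af > 0`, so fibers keep their orientation.
  have hM0 : 0 < |M| + 1 := by positivity
  have hε : 0 < min (min ε₁ ε₂) (|M| + 1)⁻¹ := lt_min (lt_min hε₁ hε₂) (inv_pos.2 hM0)
  have hmem : ∀ {t}, t ∈ Ioo (-(min (min ε₁ ε₂) (|M| + 1)⁻¹)) (min (min ε₁ ε₂) (|M| + 1)⁻¹) →
      t ∈ Ioo (-ε₁) ε₁ ∧ t ∈ Ioo (-ε₂) ε₂ ∧ |t| < (|M| + 1)⁻¹ := by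
    intro t ht
    have := abs_lt.2 ht
    rw [lt_min_iff, lt_min_iff] at this
    exact ⟨abs_lt.1 this.1.1, abs_lt.1 this.1.2, this.2⟩
  have hstart : ∀ x, Q 0 x = x := fun x => by
    rw [(hQ 0 (hmem ⟨neg_lt_zero.2 hε, hε⟩).1 x).2,
      (isHomFamily_hopfFamily hf hg hh).id_zero _ (coe_S3_ne_zero x), nrm_coe]
  refine mem_tangentAtId_iff.2 ⟨_, Q, ⟨hε, hQs.mono ?_, hstart, fun x => ?_⟩, fun t ht => ?_⟩
  · exact prod_mono (fun t ht => (hmem ht).1) subset_rfl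
  · rw [inclDeriv_combo]
    have e1 := hasDerivAt_nrm_comp (c := fun t => hopfFamily f g h t x) (r := 0)
      ((isHomFamily_hopfFamily hf hg hh).id_zero _ (coe_S3_ne_zero x))
      (inner_self_mul (re_imVec (f x) (g x) (h x)))
      (by simpa using hasDerivAt_hopfFamily f g h x)
    refine e1.congr_of_eventuallyEq ?_
    filter_upwards [isOpen_Ioo.mem_nhds (⟨neg_lt_zero.2 hε₁, hε₁⟩ : (0 : ℝ) ∈ Ioo (-ε₁) ε₁)] with t ht
    rw [(hQ t ht x).2]
  · obtain ⟨ht1, ht2, ht3⟩ := hmem ht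
    have hQG : ∀ x, Q t x = rotS (G t x) (t * f x) := fun x => by
      rw [(hQ t ht1 x).2, (hG t ht2 x).2, hopfFamily_eq, nrm_mul_rot _ (hG t ht2 x).1]
    have hGr : ∀ x θ, G t (rotS x θ) = rotS (G t x) θ := fun x θ => by
      rw [(hG t ht2 _).2, (hG t ht2 x).2, hopfFamily_rotS hg hh h1 h2,
        nrm_mul_rot _ (hG t ht2 x).1]
    have hQr : ∀ x θ, Q t (rotS x θ) = rotS (Q t x) (θ + t * f (rotS x θ) - t * f x) :=
      fun x θ => by
        rw [hQG, hQG, hGr, rotS_rotS, rotS_rotS]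
        congr 1
        ring
    intro x
    constructor
    · ext z
      rw [mem_hopfFiber_iff]
      constructor
      · rintro ⟨y, hy, rfl⟩
        obtain ⟨θ, rfl⟩ := mem_hopfFiber_iff.1 hy
        exact ⟨_, hQr x θ⟩
      · rintro ⟨φ, rfl⟩
        obtain ⟨y, hy⟩ := (Q t).surjective (rotS (Q t x) φ)
        -- The angle is forced by undoing the twist in `rotS (G t y) (t f y) = rotS (G t x) (t f x +
        -- φ)`; injectivity of `G t` then locates `y`.
        refine ⟨y, mem_hopfFiber_iff.2 ⟨t * f x + φ - t * f y, ?_⟩, hy⟩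
        apply (G t).injective
        change G t y = G t _
        change Q t y = _ at hy
        rw [hGr]
        rw [hQG, hQG, rotS_rotS] at hy
        have := congrArg (fun z => rotS z (-(t * f y))) hy
        simp only [rotS_rotS, add_neg_cancel, rotS_zero] at this
        rw [this]
        congr 1
    · refine ⟨1 + t * dirDeriv fieldA f x, ?_, inclDeriv_injective _ ?_⟩
      · have e1 : |t * dirDeriv fieldA f x| < 1 := by
          rw [abs_mul]
          have e2 : |dirDeriv fieldA f x| ≤ |M| := (hM x).trans (le_abs_self M)
          have e3 : |t| * (|M| + 1) < 1 := by
            have := mul_lt_mul_of_pos_right ht3 hM0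
            rwa [inv_mul_cancel₀ hM0.ne'] at this
          nlinarith [abs_nonneg t]
        linarith [(abs_lt.1 e1).1]
      · rw [inclDeriv_diffDeriv, inclDeriv_fieldA, map_smul, inclDeriv_fieldA]
        have e1 : HasFDerivAt (fun q => (Q t (nrm q) : ℍ[ℝ]))
            (fderiv ℝ (fun q => (Q t (nrm q) : ℍ[ℝ])) x) ((x : ℍ[ℝ]) * rot 0) := by
          rw [rot_zero, mul_one]
          exact ((contDiffAt_comp_nrm (contMDiff_val.comp (Q t).contMDiff_toFun)
            (coe_S3_ne_zero x)).differentiableAt (by simp)).hasFDerivAt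
        have e2 := e1.comp_hasDerivAt 0 (hasDerivAt_mul_rot x 0)
        have e3 : HasDerivAt (fun θ => θ + t * f (rotS x θ) - t * f x)
            (1 + t * dirDeriv fieldA f x) 0 := by
          simpa using ((hasDerivAt_id (0 : ℝ)).add
            ((hasDerivAt_comp_rotS hf x 0).const_mul t)).sub_const (t * f x)
        have e4 : HasDerivAt (fun θ => (Q t x : ℍ[ℝ]) * rot θ) (Q t x * quatI)
            ((0 : ℝ) + t * f (rotS x 0) - t * f x) := by
          simpa using hasDerivAt_mul_rot (Q t x : ℍ[ℝ]) 0
        have e5 := e4.scomp (0 : ℝ) e3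
        rw [rot_zero, mul_one] at e2
        refine e2.unique (e5.congr_of_eventuallyEq (Filter.Eventually.of_forall fun θ => ?_))
        change (Q t (nrm (rotS x θ)) : ℍ[ℝ]) = _
        rw [nrm_coe, hQr]
        rfl

end Hopf

theorem inner_mul_quatI (p q : ℍ[ℝ]) : ⟪p * quatI, q⟫_ℝ = -⟪p, q * quatI⟫_ℝ := by
  simp [inner_eq_sum]
  ring

theorem mul_quatI_mul_quatI (p : ℍ[ℝ]) : p * quatI * quatI = -p := by
  ext <;> simp

/-! ### The degree-two Hamiltonian and its Euler steps -/

section Hamiltonian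

variable {f : S3 → ℝ}

/-- The homogeneous Hamiltonian of degree two which restricts to `f` on the sphere. -/
def hamiltonian (f : S3 → ℝ) (q : ℍ[ℝ]) : ℝ := ⟪q, q⟫_ℝ * f (nrm q)

/-- The Hamiltonian vector field of `hamiltonian f` for the symplectic form `⟪p i, q⟫`. -/
def hamField (f : S3 → ℝ) (q : ℍ[ℝ]) : ℍ[ℝ] :=
  (-(1 / 2) * fderiv ℝ (hamiltonian f) q quatI) • (1 : ℍ[ℝ]) +
    imVec ((1 / 2) * fderiv ℝ (hamiltonian f) q 1) ((1 / 2) * fderiv ℝ (hamiltonian f) q quatK)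
      (-(1 / 2) * fderiv ℝ (hamiltonian f) q quatJ)

theorem contDiffAt_hamiltonian (hf : IsSmooth f) {q : ℍ[ℝ]} (hq : q ≠ 0) :
    ContDiffAt ℝ ∞ (hamiltonian f) q :=
  (contDiffAt_id.inner ℝ contDiffAt_id).mul (contDiffAt_comp_nrm hf hq)

theorem contDiffAt_hamField (hf : IsSmooth f) {q : ℍ[ℝ]} (hq : q ≠ 0) :
    ContDiffAt ℝ ∞ (hamField f) q := by
  have h1 : ContDiffAt ℝ ∞ (fderiv ℝ (hamiltonian f)) q :=
    (contDiffAt_hamiltonian hf hq).fderiv_right (by simp)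
  have h2 : ∀ c a, ContDiffAt ℝ ∞ (fun q => c * fderiv ℝ (hamiltonian f) q a) q := fun c a =>
    contDiffAt_const.mul (h1.clm_apply contDiffAt_const)
  exact ((h2 _ _).smul contDiffAt_const).add (contDiffAt_imVec (h2 _ _) (h2 _ _) (h2 _ _))

/-- This relation determines the field: the coefficients in `hamField` are its values at `v = 1, i,
j, k`. -/
theorem inner_hamField (f : S3 → ℝ) (q v : ℍ[ℝ]) :
    ⟪hamField f q, v⟫_ℝ = -(1 / 2) * fderiv ℝ (hamiltonian f) q (v * quatI) := by
  have hv : v * quatI = (-v.imI) • (1 : ℍ[ℝ]) + v.re • quatI + v.imK • quatJ + (-v.imJ) • quatK := by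
    ext <;> simp
  rw [hv]
  simp only [map_add, map_smul, hamField, inner_eq_sum, smul_eq_mul]
  simp
  ring

theorem inner_hamField_mul_quatI (f : S3 → ℝ) (q v : ℍ[ℝ]) :
    ⟪hamField f q * quatI, v⟫_ℝ = -(1 / 2) * fderiv ℝ (hamiltonian f) q v := by
  rw [inner_mul_quatI, inner_hamField, mul_quatI_mul_quatI, map_neg]
  ring

theorem fderiv_hamiltonian_smul (f : S3 → ℝ) {r : ℝ} (hr : 0 < r) (q : ℍ[ℝ]) :
    fderiv ℝ (hamiltonian f) (r • q) = r • fderiv ℝ (hamiltonian f) q := by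
  have h : (fun q => hamiltonian f (r • q)) = r ^ 2 • hamiltonian f := by
    funext q
    simp only [hamiltonian, nrm_smul hr, real_inner_smul_left, real_inner_smul_right,
      Pi.smul_apply, smul_eq_mul]
    ring
  have h1 : fderiv ℝ (fun q => hamiltonian f (r • q)) q = r • fderiv ℝ (hamiltonian f) (r • q) :=
    fderiv_comp_smul _
  rw [h, fderiv_const_smul_field, pow_two, mul_smul] at h1
  exact (smul_right_injective _ hr.ne' h1).symm

theorem hamField_smul (f : S3 → ℝ) {r : ℝ} (hr : 0 < r) (q : ℍ[ℝ]) :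
    hamField f (r • q) = r • hamField f q := by
  rw [hamField, hamField, fderiv_hamiltonian_smul f hr]
  ext <;> simp <;> ring

theorem fderiv_hamiltonian (hf : IsSmooth f) (x : S3) (w : ℍ[ℝ]) :
    fderiv ℝ (hamiltonian f) x w =
      2 * ⟪(x : ℍ[ℝ]), w⟫_ℝ * f x + fderiv ℝ (fun q => f (nrm q)) x w := by
  have h1 := ((hasFDerivAt_id (x : ℍ[ℝ])).inner ℝ (hasFDerivAt_id (x : ℍ[ℝ]))).mul
    ((contDiffAt_comp_nrm hf (coe_S3_ne_zero x)).differentiableAt (by simp)).hasFDerivAt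
  have h2 : fderiv ℝ (hamiltonian f) x = _ := h1.fderiv
  rw [h2]
  simp [real_inner_comm w, fderivInnerCLM_apply]
  ring

/-- On the sphere, the Hamiltonian field is the contact field of `f` plus a radial component. -/
theorem hamField_coe (hf : IsSmooth f) (x : S3) :
    hamField f x = (-(1 / 2) * dirDeriv fieldA f x) • (x : ℍ[ℝ]) +
      x * imVec (f x) ((1 / 2) * dirDeriv fieldC f x) (-(1 / 2) * dirDeriv fieldB f x) := by
  have hx : (x : ℍ[ℝ]) * star (x : ℍ[ℝ]) = 1 := by
    rw [Quaternion.self_mul_star, Quaternion.normSq_eq_norm_mul_self, norm_coe_S3]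
    simp
  obtain ⟨u, hu⟩ : ∃ u, hamField f x = x * u :=
    ⟨star (x : ℍ[ℝ]) * hamField f x, by rw [← mul_assoc, hx, one_mul]⟩
  have key : ∀ a : ℍ[ℝ], ⟪u, a⟫_ℝ = -(1 / 2) * (2 * ⟪1, a * quatI⟫_ℝ * f x +
      fderiv ℝ (fun q => f (nrm q)) x (x * (a * quatI))) := fun a => by
    rw [← inner_mul_mul x u a, ← hu, inner_hamField, fderiv_hamiltonian hf,
      mul_assoc (x : ℍ[ℝ]), ← inner_mul_mul x 1, mul_one]
  have k0 := key 1
  have k1 := key quatI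
  have k2 := key quatJ
  have k3 := key quatK
  have e1 : quatI * quatI = -1 := by ext <;> simp
  have e2 : quatJ * quatI = -quatK := by ext <;> simp
  have e3 : quatK * quatI = quatJ := by ext <;> simp
  rw [e1, mul_neg, mul_one, map_neg, fderiv_comp_nrm_self hf] at k1
  rw [e2, mul_neg, map_neg] at k2
  rw [e3] at k3
  rw [one_mul] at k0
  simp only [inner_eq_sum] at k0 k1 k2 k3
  simp at k0 k1 k2 k3
  rw [dirDeriv_eq hf, dirDeriv_eq hf, dirDeriv_eq hf, inclDeriv_fieldA, inclDeriv_fieldB,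
    inclDeriv_fieldC, hu]
  rw [← mul_one (x : ℍ[ℝ]), mul_assoc, ← mul_smul_comm]
  simp only [mul_one, ← mul_add]
  congr 1
  ext
  · simp [k0]
  · simp [k1]
  · simp [k2]
  · simp [k3]

/-- Euler's identity for the derivative of the Hamiltonian, which is homogeneous of degree one. -/
theorem fderiv_fderiv_hamiltonian_self (hf : IsSmooth f) {q : ℍ[ℝ]} (hq : q ≠ 0)
    (v : ℍ[ℝ]) : fderiv ℝ (fderiv ℝ (hamiltonian f)) q q v = fderiv ℝ (hamiltonian f) q v := by
  have h1 : HasDerivAt (fun s : ℝ => s • q) q 1 := by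
    simpa using (hasDerivAt_id (1 : ℝ)).smul_const q
  have h2 : HasFDerivAt (fderiv ℝ (hamiltonian f)) (fderiv ℝ (fderiv ℝ (hamiltonian f)) q)
      ((1 : ℝ) • q) := by
    rw [one_smul]
    exact (((contDiffAt_hamiltonian hf hq).fderiv_right (m := 1) (by norm_cast)).differentiableAt
      (by simp)).hasFDerivAt
  have h3 : HasDerivAt (fun s : ℝ => fderiv ℝ (hamiltonian f) (s • q))
      (fderiv ℝ (fderiv ℝ (hamiltonian f)) q q) 1 := HasFDerivAt.comp_hasDerivAt (l := fderiv ℝ (hamiltonian f)) (1 : ℝ) h2 h1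
  have h4 := (ContinuousLinearMap.apply ℝ ℝ v).hasFDerivAt.comp_hasDerivAt (1 : ℝ) h3
  have h5 : HasDerivAt (fun s : ℝ => s * fderiv ℝ (hamiltonian f) q v)
      (fderiv ℝ (hamiltonian f) q v) 1 := by
    simpa using (hasDerivAt_id (1 : ℝ)).mul_const (fderiv ℝ (hamiltonian f) q v)
  refine h4.unique (h5.congr_of_eventuallyEq ?_)
  filter_upwards [lt_mem_nhds one_pos] with s hs
  exact congrArg (fun L : ℍ[ℝ] →L[ℝ] ℝ => L v) (fderiv_hamiltonian_smul f hs q)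

/-- The Liouville form `⟪q i, ·⟫` is invariant under the Hamiltonian field. -/
theorem inner_add_inner_fderiv_hamField (hf : IsSmooth f) {q : ℍ[ℝ]} (hq : q ≠ 0) (v : ℍ[ℝ]) :
    ⟪hamField f q * quatI, v⟫_ℝ + ⟪q * quatI, fderiv ℝ (hamField f) q v⟫_ℝ = 0 := by
  have h1 : HasFDerivAt (fun p => ⟪q * quatI, hamField f p⟫_ℝ)
      ((innerSL ℝ (q * quatI)).comp (fderiv ℝ (hamField f) q)) q :=
    (innerSL ℝ (q * quatI)).hasFDerivAt.comp q
      ((contDiffAt_hamField hf hq).differentiableAt (by simp)).hasFDerivAt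
  have h2 : HasFDerivAt (fderiv ℝ (hamiltonian f)) (fderiv ℝ (fderiv ℝ (hamiltonian f)) q) q :=
    (((contDiffAt_hamiltonian hf hq).fderiv_right (m := 1) (by norm_cast)).differentiableAt
      (by simp)).hasFDerivAt
  have h3 : HasFDerivAt (fun p => (1 / 2 : ℝ) • fderiv ℝ (hamiltonian f) p q)
      ((1 / 2 : ℝ) • (ContinuousLinearMap.apply ℝ ℝ q).comp
        (fderiv ℝ (fderiv ℝ (hamiltonian f)) q)) q :=
    ((ContinuousLinearMap.apply ℝ ℝ q).hasFDerivAt.comp q h2).const_smul (1 / 2 : ℝ)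
  -- With `q` frozen, pairing the field with `q i` gives half of `dH(q)`. Differentiating in `p`
  -- yields a Hessian term, which symmetry and Euler's identity reduce to `dH(v) / 2`, cancelling
  -- the other summand.
  have h4 : (fun p => ⟪q * quatI, hamField f p⟫_ℝ) =
      fun p => (1 / 2 : ℝ) • fderiv ℝ (hamiltonian f) p q := by
    funext p
    rw [real_inner_comm, inner_hamField, mul_quatI_mul_quatI, map_neg, smul_eq_mul]
    ring
  rw [h4] at h1
  have h5 := congrArg (fun L : ℍ[ℝ] →L[ℝ] ℝ => L v) (h1.unique h3)
  have hsymm : IsSymmSndFDerivAt ℝ (hamiltonian f) q :=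
    (contDiffAt_hamiltonian hf hq).isSymmSndFDerivAt
      (by rw [minSmoothness_of_isRCLikeNormedField]; norm_cast)
  have h6 : ⟪q * quatI, fderiv ℝ (hamField f) q v⟫_ℝ =
      (1 / 2) * fderiv ℝ (fderiv ℝ (hamiltonian f)) q v q := h5
  rw [h6, hsymm.eq, fderiv_fderiv_hamiltonian_self hf hq, inner_hamField_mul_quatI]
  ring

/-- The Euler steps of the Hamiltonian field. -/
def eulerStep (f : S3 → ℝ) (t : ℝ) (q : ℍ[ℝ]) : ℍ[ℝ] := q + t • hamField f q

theorem isHomFamily_eulerStep (hf : IsSmooth f) : IsHomFamily (eulerStep f) where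
  smooth t q hq := contDiffAt_snd.add (contDiffAt_fst.smul
    (ContDiffAt.comp (g := hamField f) (t, q) (contDiffAt_hamField hf hq) contDiffAt_snd))
  hom t r hr q := by simp [eulerStep, hamField_smul f hr, smul_comm t r]
  id_zero q _ := by simp [eulerStep]

theorem hasFDerivAt_eulerStep (hf : IsSmooth f) (t : ℝ) {q : ℍ[ℝ]} (hq : q ≠ 0) :
    HasFDerivAt (eulerStep f t)
      (ContinuousLinearMap.id ℝ ℍ[ℝ] + t • fderiv ℝ (hamField f) q) q :=
  (hasFDerivAt_id q).add
    (((contDiffAt_hamField hf hq).differentiableAt (by simp)).hasFDerivAt.const_smul t)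

/-- The term linear in `t` is the infinitesimal invariance of the Liouville form, hence zero. The
remaining error depends on `t` only through `t ^ 2`, so it is the same for `t` and `-t`. -/
theorem inner_eulerStep (hf : IsSmooth f) (t : ℝ) {q : ℍ[ℝ]} (hq : q ≠ 0) (v : ℍ[ℝ]) :
    ⟪eulerStep f t q * quatI, v + t • fderiv ℝ (hamField f) q v⟫_ℝ =
      ⟪q * quatI, v⟫_ℝ + t ^ 2 * ⟪hamField f q * quatI, fderiv ℝ (hamField f) q v⟫_ℝ := by
  have h := inner_add_inner_fderiv_hamField hf hq v
  simp only [eulerStep, add_mul, smul_mul_assoc, inner_add_left, inner_add_right,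
    real_inner_smul_left, real_inner_smul_right]
  linear_combination t * h

/-- The contact form along the diffeomorphism induced by an Euler step. -/
theorem contactForm_diffDeriv_eulerStep (hf : IsSmooth f) {t : ℝ} {Q : Diff}
    (hQ : ∀ x : S3, eulerStep f t x ≠ 0 ∧ Q x = nrm (eulerStep f t x)) (x : S3) (v : T x) :
    ‖eulerStep f t x‖ ^ 2 * contactForm (Q x) (diffDeriv Q x v) =
      ⟪(x : ℍ[ℝ]) * quatI, inclDeriv x v⟫_ℝ +
      t ^ 2 * ⟪hamField f x * quatI, fderiv ℝ (hamField f) x (inclDeriv x v)⟫_ℝ := by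
  have hx := coe_S3_ne_zero x
  have hp := (hQ x).1
  rw [contactForm_apply, inclDeriv_diffDeriv, ← inner_eulerStep hf t hx]
  have h1 := hasFDerivAt_eulerStep hf t hx
  have h2 : HasFDerivAt (fun q => ‖eulerStep f t q‖⁻¹)
      (fderiv ℝ (fun q => ‖eulerStep f t q‖⁻¹) x) (x : ℍ[ℝ]) :=
    ((h1.differentiableAt.norm ℝ hp).inv (norm_ne_zero_iff.2 hp)).hasFDerivAt
  have h3 := h2.smul h1
  have h4 : (fun q => (Q (nrm q) : ℍ[ℝ])) =ᶠ[𝓝 (x : ℍ[ℝ])]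
      fun q => ‖eulerStep f t q‖⁻¹ • eulerStep f t q := by
    filter_upwards [isOpen_compl_singleton.mem_nhds hx] with q hq
    have hr := inv_pos.2 (norm_pos_iff.2 hq)
    have e := (isHomFamily_eulerStep hf).hom t _ hr q
    rw [(hQ _).2, coe_nrm hq, e, nrm_smul hr, coe_nrm]
    intro h0
    apply (hQ (nrm q)).1
    rw [coe_nrm hq, e, h0, smul_zero]
  rw [(h3.congr_of_eventuallyEq h4).fderiv, (hQ x).2, coe_nrm hp]
  -- Differentiating the normalising factor produces only a multiple of the Euler step itself, which
  -- this orthogonality kills.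
  have h5 : ⟪eulerStep f t x * quatI, eulerStep f t x⟫_ℝ = 0 := by
    simp [inner_eq_sum]
    ring
  have h6 : ‖eulerStep f t x‖ ≠ 0 := norm_ne_zero_iff.2 hp
  simp [real_inner_smul_left, real_inner_smul_right, inner_add_right, h5]
  field_simp

end Hamiltonian

/-! ### The midpoint rule and curves of contactomorphisms -/

theorem fderiv_symm_trans (K L : Diff) (y : S3) (u : T y) :
    inclDeriv _ (diffDeriv (K.symm.trans L) (K y) (diffDeriv K y u)) =
      inclDeriv (L y) (diffDeriv L y u) := by
  have d : ∀ (F : Diff) (x : S3), HasFDerivAt (fun q => (F (nrm q) : ℍ[ℝ]))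
      (fderiv ℝ (fun q => (F (nrm q) : ℍ[ℝ])) x) (x : ℍ[ℝ]) := fun F x =>
    ((contDiffAt_comp_nrm (contMDiff_val.comp F.contMDiff_toFun)
      (coe_S3_ne_zero x)).differentiableAt (by simp)).hasFDerivAt
  rw [inclDeriv_diffDeriv, inclDeriv_diffDeriv, inclDeriv_diffDeriv]
  have h1 : HasFDerivAt (fun q => ((K.symm.trans L) (nrm q) : ℍ[ℝ]))
      (fderiv ℝ (fun q => ((K.symm.trans L) (nrm q) : ℍ[ℝ])) (K y)) (K (nrm y) : ℍ[ℝ]) := by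
    rw [nrm_coe]
    exact d _ _
  have h2 := (h1.comp (y : ℍ[ℝ]) (d K y)).fderiv
  have h3 : ((fun q => ((K.symm.trans L) (nrm q) : ℍ[ℝ])) ∘ fun q => (K (nrm q) : ℍ[ℝ])) =
      fun q => (L (nrm q) : ℍ[ℝ]) := by
    funext q
    simp
  rw [h3] at h2
  rw [h2]
  rfl

theorem diffDeriv_surjective (F : Diff) (x : S3) : Function.Surjective (diffDeriv F x) :=
  (F.mfderivToContinuousLinearEquiv (by simp) x).surjective

/-- A nonzero conformal factor makes the kernels correspond; surjectivity of the differential gives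
equality with the target plane and not just inclusion. -/
theorem mem_autContact_of_forall {F : Diff}
    (h : ∀ x, ∃ ρ : ℝ, ρ ≠ 0 ∧ ∀ v, contactForm (F x) (diffDeriv F x v) = ρ * contactForm x v) :
    F ∈ AutContact := by
  intro x
  obtain ⟨ρ, hρ, h⟩ := h x
  ext w
  simp only [contactPlane, Submodule.mem_map, LinearMap.mem_ker]
  constructor
  · rintro ⟨v, hv, rfl⟩
    exact (h v).trans (by rw [hv, mul_zero])
  · intro hw
    obtain ⟨v, rfl⟩ := diffDeriv_surjective F x w
    rw [h] at hw
    exact ⟨v, (mul_eq_zero.1 hw).resolve_left hρ, rfl⟩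

theorem hasDerivAt_nrm_eulerStep {f : S3 → ℝ} (hf : IsSmooth f) (x : S3) :
    HasDerivAt (fun t => (nrm (eulerStep f t x) : ℍ[ℝ]))
      (x * imVec (f x) ((1 / 2) * dirDeriv fieldC f x) (-(1 / 2) * dirDeriv fieldB f x)) 0 := by
  refine hasDerivAt_nrm_comp (c := fun t => eulerStep f t x) (r := -(1 / 2) * dirDeriv fieldA f x)
    (by simp [eulerStep]) (inner_self_mul (re_imVec _ _ _)) ?_
  rw [← hamField_coe hf]
  simpa [eulerStep] using ((hasDerivAt_id (0 : ℝ)).smul_const (hamField f x)).const_add (x : ℍ[ℝ])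

/-- When `Af = 0` the Hamiltonian field has no radial component on the sphere, so the cross term in
the squared norm vanishes. -/
theorem norm_eulerStep_neg {f : S3 → ℝ} (hf : IsSmooth f) {x : S3} (h : dirDeriv fieldA f x = 0)
    (t : ℝ) : ‖eulerStep f (-t) x‖ ^ 2 = ‖eulerStep f t x‖ ^ 2 := by
  have h1 : ⟪(x : ℍ[ℝ]), hamField f x⟫_ℝ = 0 := by
    rw [hamField_coe hf, h, mul_zero, zero_smul, zero_add, inner_self_mul (re_imVec _ _ _)]
  rw [eulerStep, eulerStep, norm_add_sq_real, norm_add_sq_real, real_inner_smul_right,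
    real_inner_smul_right, h1, norm_smul, norm_smul, norm_neg]
  ring

theorem contactForm_symm_trans (K L : Diff) (y : S3) (u : T y) :
    contactForm _ (diffDeriv (K.symm.trans L) (K y) (diffDeriv K y u)) =
      contactForm (L y) (diffDeriv L y u) := by
  rw [contactForm_apply, contactForm_apply, fderiv_symm_trans]
  simp

/-- The implicit midpoint rule integrates a contact Hamiltonian by contactomorphisms. -/
theorem exists_midpoint_curve {f : S3 → ℝ} (hf : IsSmooth f) : ∃ ε F,
    IsCurve F ε (combo f (fun x => (1 / 2) * dirDeriv fieldC f x)
      (fun x => -(1 / 2) * dirDeriv fieldB f x)) ∧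
    ∀ t ∈ Ioo (-ε) ε, ∀ x, ∃ y : S3, eulerStep f (t / 2) y ≠ 0 ∧ eulerStep f (-(t / 2)) y ≠ 0 ∧
      ∀ v, ‖eulerStep f (t / 2) y‖ ^ 2 * contactForm (F t x) (diffDeriv (F t) x v) =
        ‖eulerStep f (-(t / 2)) y‖ ^ 2 * contactForm x v := by
  obtain ⟨ε, hε, Q, hQ, hQs, hQi⟩ := (isHomFamily_eulerStep hf).exists_diffeo
  have hm : ∀ {t}, t ∈ Ioo (-ε) ε → t / 2 ∈ Ioo (-ε) ε ∧ -(t / 2) ∈ Ioo (-ε) ε := by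
    rintro t ⟨h1, h2⟩
    exact ⟨⟨by linarith, by linarith⟩, ⟨by linarith, by linarith⟩⟩
  have h0m : (0 : ℝ) ∈ Ioo (-ε) ε := ⟨neg_lt_zero.2 hε, hε⟩
  -- The point `y` with `Q (-(t / 2)) y = x` plays the role of the midpoint: both half steps start
  -- from it, so their quadratic errors agree and cancel.
  let F : ℝ → Diff := fun t => (Q (-(t / 2))).symm.trans (Q (t / 2))
  have hFQ : ∀ t x, F t (Q (-(t / 2)) x) = Q (t / 2) x := fun t x => by simp [F]
  have hQ0 : ∀ x, Q 0 x = x := fun x => by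
    rw [(hQ 0 h0m x).2, (isHomFamily_eulerStep hf).id_zero _ (coe_S3_ne_zero x), nrm_coe]
  have hF0 : ∀ x, F 0 x = x := fun x => by
    have := hFQ 0 x
    simpa [hQ0] using this
  have hFs : ContMDiffOn (𝓘(ℝ, ℝ).prod (𝓡 3)) (𝓡 3) ∞ (fun p : ℝ × S3 => F p.1 p.2)
      (Ioo (-ε) ε ×ˢ univ) := by
    have e1 : ContMDiffOn (𝓘(ℝ, ℝ).prod (𝓡 3)) (𝓘(ℝ, ℝ).prod (𝓡 3)) ∞
        (fun p : ℝ × S3 => (-(p.1 / 2), p.2)) (Ioo (-ε) ε ×ˢ univ) := by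
      have : ContDiff ℝ ∞ (fun t : ℝ => -(t / 2)) := by fun_prop
      exact ((this.contMDiff.comp contMDiff_fst).prodMk contMDiff_snd).contMDiffOn
    have e2 := hQi.comp e1 (fun p hp => ⟨(hm hp.1).2, mem_univ _⟩)
    have e3 : ContMDiffOn (𝓘(ℝ, ℝ).prod (𝓡 3)) 𝓘(ℝ, ℝ) ∞
        (fun p : ℝ × S3 => p.1 / 2) (Ioo (-ε) ε ×ˢ univ) := by
      have : ContDiff ℝ ∞ (fun t : ℝ => t / 2) := by fun_prop
      exact (this.contMDiff.comp contMDiff_fst).contMDiffOn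
    exact hQs.comp (e3.prodMk e2) (fun p hp => ⟨(hm hp.1).1, mem_univ _⟩)
  refine ⟨ε, F, ⟨hε, hFs, hF0, fun x => ?_⟩, fun t ht x => ?_⟩
  · rw [inclDeriv_combo]
    set w := (x : ℍ[ℝ]) * imVec (f x) ((1 / 2) * dirDeriv fieldC f x)
      (-(1 / 2) * dirDeriv fieldB f x) with hw
    have hΨ := (contDiffAt_family isOpen_Ioo (F := fun t => F t) hFs h0m
      (coe_S3_ne_zero x)).differentiableAt (by simp) |>.hasFDerivAt
    set L := fderiv ℝ (fun p : ℝ × ℍ[ℝ] => (F p.1 (nrm p.2) : ℍ[ℝ])) (0, (x : ℍ[ℝ])) with hL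
    have e0 : HasDerivAt (fun t => (Q t x : ℍ[ℝ])) w 0 := by
      refine (hasDerivAt_nrm_eulerStep hf x).congr_of_eventuallyEq ?_
      filter_upwards [isOpen_Ioo.mem_nhds h0m] with t ht
      rw [(hQ t ht x).2]
    have ep : HasDerivAt (fun t : ℝ => (Q (t / 2) x : ℍ[ℝ])) ((1 / 2 : ℝ) • w) 0 := by
      have h1 : HasDerivAt (fun t : ℝ => t / 2) (1 / 2) 0 := (hasDerivAt_id 0).div_const 2
      exact HasDerivAt.scomp_of_eq (0 : ℝ) e0 h1 (by simp)
    have en : HasDerivAt (fun t : ℝ => (Q (-(t / 2)) x : ℍ[ℝ])) ((-(1 / 2) : ℝ) • w) 0 := by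
      have h1 : HasDerivAt (fun t : ℝ => -(t / 2)) (-(1 / 2)) 0 :=
        ((hasDerivAt_id 0).div_const 2).neg
      exact HasDerivAt.scomp_of_eq (0 : ℝ) e0 h1 (by simp)
    have e1 : HasDerivAt (fun t : ℝ => (t, (Q (-(t / 2)) x : ℍ[ℝ])))
        ((1 : ℝ), (-(1 / 2) : ℝ) • w) 0 := (hasDerivAt_id 0).prodMk en
    have e2 := hΨ.comp_hasDerivAt_of_eq (0 : ℝ) e1 (by simp [hQ0])
    -- Differentiating `F_t(Q_{-t/2} x) = Q_{t/2} x` gives `L (1, -w/2) = w/2`. As `F_0 = id` gives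
    -- `L (0, w) = w`, the velocity `L (1, 0)` is `w`.
    have e3 : HasDerivAt (fun t : ℝ => (Q (t / 2) x : ℍ[ℝ])) (L (1, (-(1 / 2) : ℝ) • w)) 0 := by
      refine e2.congr_of_eventuallyEq (Filter.Eventually.of_forall fun t => ?_)
      simp [hFQ]
    have e4 := e3.unique ep
    have e5 : HasDerivAt (fun t : ℝ => (F t x : ℍ[ℝ])) (L (1, 0)) 0 := by
      have h1 : HasDerivAt (fun t : ℝ => (t, (x : ℍ[ℝ]))) ((1 : ℝ), (0 : ℍ[ℝ])) 0 :=
        (hasDerivAt_id 0).prodMk (hasDerivAt_const 0 _)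
      have h2 := hΨ.comp_hasDerivAt (0 : ℝ) h1
      refine h2.congr_of_eventuallyEq (Filter.Eventually.of_forall fun t => ?_)
      simp
    have e6 : L (0, w) = w := by
      have h1 : HasFDerivAt (fun q : ℍ[ℝ] => (F 0 (nrm q) : ℍ[ℝ]))
          (L.comp (ContinuousLinearMap.inr ℝ ℝ ℍ[ℝ])) (x : ℍ[ℝ]) :=
        hΨ.comp (x : ℍ[ℝ]) (hasFDerivAt_prodMk_right _ _)
      simp only [hF0] at h1
      have h2 := congrArg (fun L : ℍ[ℝ] →L[ℝ] ℍ[ℝ] => L w) h1.fderiv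
      exact h2.symm.trans (fderiv_nrm (inner_self_mul (re_imVec _ _ _)))
    have e7 : L (1, 0) = w := by
      have h1 : ((1 : ℝ), (0 : ℍ[ℝ])) = (1, (-(1 / 2) : ℝ) • w) + (1 / 2 : ℝ) • (0, w) := by
        ext1 <;> simp
      rw [h1, map_add, map_smul, e4, e6, ← add_smul]
      norm_num
    rwa [e7] at e5
  · obtain ⟨htp, htn⟩ := hm ht
    obtain ⟨y, rfl⟩ : ∃ y, Q (-(t / 2)) y = x := (Q (-(t / 2))).surjective x
    refine ⟨y, (hQ _ htp y).1, (hQ _ htn y).1, fun v => ?_⟩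
    obtain ⟨u, rfl⟩ := diffDeriv_surjective (Q (-(t / 2))) y v
    have e1 := contactForm_symm_trans (Q (-(t / 2))) (Q (t / 2)) y u
    have e2 := contactForm_diffDeriv_eulerStep hf (hQ _ htp) y u
    have e3 := contactForm_diffDeriv_eulerStep hf (hQ _ htn) y u
    rw [neg_sq] at e3
    exact (congrArg (fun c => ‖eulerStep f (t / 2) y‖ ^ 2 * c) e1).trans (e2.trans e3.symm)

theorem mem_tangentAtId_autContact {f : S3 → ℝ} (hf : IsSmooth f) :
    combo f (fun x => (1 / 2) * dirDeriv fieldC f x) (fun x => -(1 / 2) * dirDeriv fieldB f x) ∈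
      tangentAtId AutContact := by
  obtain ⟨ε, F, hF, h⟩ := exists_midpoint_curve hf
  refine mem_tangentAtId_iff.2 ⟨ε, F, hF, fun t ht => mem_autContact_of_forall fun x => ?_⟩
  obtain ⟨y, h1, h2, h3⟩ := h t ht x
  have h1' := pow_ne_zero 2 (norm_ne_zero_iff.2 h1)
  have h2' := pow_ne_zero 2 (norm_ne_zero_iff.2 h2)
  refine ⟨_, div_ne_zero h2' h1', fun v => ?_⟩
  rw [div_mul_eq_mul_div, ← h3, mul_div_cancel_left₀ _ h1']

theorem mem_tangentAtId_autContactStrict {f : S3 → ℝ} (hf : IsSmooth f)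
    (hA : ∀ x, dirDeriv fieldA f x = 0) :
    combo f (fun x => (1 / 2) * dirDeriv fieldC f x) (fun x => -(1 / 2) * dirDeriv fieldB f x) ∈
      tangentAtId AutContactStrict := by
  obtain ⟨ε, F, hF, h⟩ := exists_midpoint_curve hf
  refine mem_tangentAtId_iff.2 ⟨ε, F, hF, fun t ht x v => ?_⟩
  obtain ⟨y, h1, -, h3⟩ := h t ht x
  have h3 := h3 v
  rw [norm_eulerStep_neg hf (hA y)] at h3
  exact mul_left_cancel₀ (pow_ne_zero 2 (norm_ne_zero_iff.2 h1)) h3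

/-! ### The commutator relation and the divergence -/

/-- Differentiating `y ↦ d(f ∘ nrm)_y (y c)` along `x b` gives a Hessian term and the first-order
term in `x b c`. In a commutator the Hessians cancel and only `b c - c b` remains. -/
theorem dirDeriv_dirDeriv {V W : VectorField} {b c : ℍ[ℝ]} (hV : ∀ x, inclDeriv x (V x) = x * b)
    (hW : ∀ x, inclDeriv x (W x) = x * c) {f : S3 → ℝ} (hf : IsSmooth f) (x : S3) :
    dirDeriv V (dirDeriv W f) x =
      fderiv ℝ (fderiv ℝ fun q => f (nrm q)) x (x * b) (x * c) +
        fderiv ℝ (fun q => f (nrm q)) x (x * b * c) := by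
  have hx := coe_S3_ne_zero x
  have hw : ⟪(x : ℍ[ℝ]), x * b⟫_ℝ = 0 := hV x ▸ inner_inclDeriv x (V x)
  rw [dirDeriv_eq (isSmooth_dirDeriv hW hf), hV]
  have h1 : HasFDerivAt (fderiv ℝ fun q => f (nrm q)) (fderiv ℝ (fderiv ℝ fun q => f (nrm q)) x)
      (nrm x : ℍ[ℝ]) := by
    rw [nrm_coe]
    exact (((contDiffAt_comp_nrm hf hx).fderiv_right (m := 1) (by norm_cast)).differentiableAt
      (by simp)).hasFDerivAt
  have h2 : HasFDerivAt (fun q => (nrm q : ℍ[ℝ])) (fderiv ℝ (fun q => (nrm q : ℍ[ℝ])) x)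
      (x : ℍ[ℝ]) :=
    ((contDiffAt_comp_nrm contMDiff_val hx).differentiableAt (by simp)).hasFDerivAt
  have h3 : HasFDerivAt (fun q => fderiv ℝ (fun q => f (nrm q)) (nrm q : ℍ[ℝ]))
      ((fderiv ℝ (fderiv ℝ fun q => f (nrm q)) x).comp (fderiv ℝ (fun q => (nrm q : ℍ[ℝ])) x))
      (x : ℍ[ℝ]) :=
    HasFDerivAt.comp (g := fderiv ℝ fun q => f (nrm q)) (x : ℍ[ℝ]) h1 h2
  have h4 := (h3.clm_apply (h2.mul_const' c)).fderiv
  have h5 : (fun q => dirDeriv W f (nrm q)) =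
      fun q => fderiv ℝ (fun q => f (nrm q)) (nrm q : ℍ[ℝ]) ((nrm q : ℍ[ℝ]) * c) := by
    funext q
    rw [dirDeriv_eq hf, hW]
  rw [h5, h4]
  simp [fderiv_nrm hw]
  ring

/-- The commutator relation `[B, C] = 2 A`. -/
theorem dirDeriv_commutator {f : S3 → ℝ} (hf : IsSmooth f) (x : S3) :
    dirDeriv fieldB (dirDeriv fieldC f) x - dirDeriv fieldC (dirDeriv fieldB f) x =
      2 * dirDeriv fieldA f x := by
  have hsymm : IsSymmSndFDerivAt ℝ (fun q => f (nrm q)) (x : ℍ[ℝ]) :=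
    (contDiffAt_comp_nrm hf (coe_S3_ne_zero x)).isSymmSndFDerivAt
      (by rw [minSmoothness_of_isRCLikeNormedField]; norm_cast)
  rw [dirDeriv_dirDeriv inclDeriv_fieldB inclDeriv_fieldC hf,
    dirDeriv_dirDeriv inclDeriv_fieldC inclDeriv_fieldB hf, dirDeriv_eq hf, inclDeriv_fieldA,
    hsymm.eq, mul_assoc, mul_assoc]
  have e1 : quatJ * quatK = quatI := by ext <;> simp
  have e2 : quatK * quatJ = -quatI := by ext <;> simp
  rw [e1, e2, mul_neg, map_neg]
  ring

theorem dirDeriv_const_mul (V : VectorField) {f : S3 → ℝ} (hf : IsSmooth f) (c : ℝ) (x : S3) :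
    dirDeriv V (fun y => c * f y) x = c * dirDeriv V f x := by
  have h : IsSmooth fun y => c * f y := contMDiff_const.mul hf
  rw [dirDeriv_eq h, dirDeriv_eq hf, fderiv_const_mul
    ((contDiffAt_comp_nrm hf (coe_S3_ne_zero x)).differentiableAt (by simp))]
  rfl

/-- The frame is divergence-free: for a unit imaginary `a`, `⟪a u, a⟫` is the real part of `u`,
which is zero. Only derivatives of the coefficients survive. -/
theorem divergence_combo {f g h : S3 → ℝ} (hf : IsSmooth f) (hg : IsSmooth g) (hh : IsSmooth h)
    (x : S3) : divergence (combo f g h) x =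
      dirDeriv fieldA f x + dirDeriv fieldB g x + dirDeriv fieldC h x := by
  have hs : ContMDiff (𝓡 3) 𝓘(ℝ, ℍ[ℝ]) ∞
      (fun y : S3 => inclDeriv y (combo f g h y)) := by
    have h1 : ∀ q ≠ (0 : ℍ[ℝ]), ContDiffAt ℝ ∞
        (fun q => (nrm q : ℍ[ℝ]) * imVec (f (nrm q)) (g (nrm q)) (h (nrm q))) q := fun q hq =>
      (contDiffAt_comp_nrm contMDiff_val hq).mul (contDiffAt_imVec (contDiffAt_comp_nrm hf hq)
        (contDiffAt_comp_nrm hg hq) (contDiffAt_comp_nrm hh hq))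
    refine (contMDiff_comp_val h1).congr fun y => ?_
    rw [inclDeriv_combo, nrm_coe]
  have key : ∀ (V : VectorField) (a : ℍ[ℝ]), inclDeriv x (V x) = x * a →
      ⟪(mvfderiv (𝓡 3) (fun y : S3 => inclDeriv y (combo f g h y)) x (V x) : ℍ[ℝ]),
        inclDeriv x (V x)⟫_ℝ = ⟪a * imVec (f x) (g x) (h x) +
          imVec (dirDeriv V f x) (dirDeriv V g x) (dirDeriv V h x), a⟫_ℝ := fun V a hV => by
    have hw : ⟪(x : ℍ[ℝ]), x * a⟫_ℝ = 0 := hV ▸ inner_inclDeriv x (V x)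
    obtain ⟨L, hL, hLw⟩ := hasFDerivAt_mul_imVec hf hg hh x hw
    rw [mvfderiv_eq_fderiv hs, dirDeriv_eq hf, dirDeriv_eq hg, dirDeriv_eq hh, hV]
    simp only [inclDeriv_combo]
    rw [hL.fderiv, hLw, mul_assoc, ← mul_add, inner_mul_mul]
  change ⟪(mvfderiv (𝓡 3) (fun y : S3 => inclDeriv y (combo f g h y)) x (fieldA x) : ℍ[ℝ]), _⟫_ℝ +
    ⟪(mvfderiv (𝓡 3) (fun y : S3 => inclDeriv y (combo f g h y)) x (fieldB x) : ℍ[ℝ]), _⟫_ℝ +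
    ⟪(mvfderiv (𝓡 3) (fun y : S3 => inclDeriv y (combo f g h y)) x (fieldC x) : ℍ[ℝ]), _⟫_ℝ = _
  rw [key _ _ (inclDeriv_fieldA x), key _ _ (inclDeriv_fieldB x), key _ _ (inclDeriv_fieldC x)]
  simp [inner_eq_sum]

/-! ### The three tangent spaces -/

theorem tangentAtId_autHopf : tangentAtId AutHopf =
    {X | ∃ f g h : S3 → ℝ, IsSmooth f ∧ IsSmooth g ∧ IsSmooth h ∧ X = combo f g h ∧
      (∀ x, g x = -(1 / 2) * dirDeriv fieldA h x) ∧
      (∀ x, h x = (1 / 2) * dirDeriv fieldA g x)} := by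
  ext X
  constructor
  · intro hX
    obtain ⟨ε, F, hF, hA⟩ := mem_tangentAtId_iff.1 hX
    obtain ⟨f, g, h, hf, hg, hh, rfl⟩ := hF.exists_eq_combo
    exact ⟨f, g, h, hf, hg, hh, rfl, fun x => (hF.hopf_conditions hf hg hh hA x).1,
      fun x => (hF.hopf_conditions hf hg hh hA x).2⟩
  · rintro ⟨f, g, h, hf, hg, hh, rfl, h1, h2⟩
    exact mem_tangentAtId_autHopf hf hg hh h1 h2

theorem tangentAtId_autContact : tangentAtId AutContact =
    {X | ∃ f g h : S3 → ℝ, IsSmooth f ∧ IsSmooth g ∧ IsSmooth h ∧ X = combo f g h ∧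
      (∀ x, g x = (1 / 2) * dirDeriv fieldC f x) ∧
      (∀ x, h x = -(1 / 2) * dirDeriv fieldB f x)} := by
  ext X
  constructor
  · intro hX
    obtain ⟨ε, F, hF, hA⟩ := mem_tangentAtId_iff.1 hX
    obtain ⟨f, g, h, hf, hg, hh, rfl⟩ := hF.exists_eq_combo
    have key := hF.contact_conditions hf hg hh (fun t ht x v hv => by
      have h1 : diffDeriv (F t) x v ∈ contactPlane (F t x) := by
        rw [← hA t ht x]
        exact Submodule.mem_map_of_mem (f := (diffDeriv (F t) x).toLinearMap) hv
      exact h1)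
    exact ⟨f, g, h, hf, hg, hh, rfl, fun x => (key x).1, fun x => (key x).2⟩
  · rintro ⟨f, g, h, hf, hg, hh, rfl, h1, h2⟩
    rw [funext h1, funext h2]
    exact mem_tangentAtId_autContact hf

theorem tangentAtId_autContactStrict : tangentAtId AutContactStrict =
    {X | ∃ f g h : S3 → ℝ, IsSmooth f ∧ IsSmooth g ∧ IsSmooth h ∧ X = combo f g h ∧
      (∀ x, dirDeriv fieldA f x = 0) ∧
      (∀ x, g x = (1 / 2) * dirDeriv fieldC f x) ∧
      (∀ x, h x = -(1 / 2) * dirDeriv fieldB f x)} := by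
  ext X
  constructor
  · intro hX
    obtain ⟨ε, F, hF, hA⟩ := mem_tangentAtId_iff.1 hX
    obtain ⟨f, g, h, hf, hg, hh, rfl⟩ := hF.exists_eq_combo
    have key := hF.contact_conditions hf hg hh (fun t ht x v hv => (hA t ht x v).trans hv)
    exact ⟨f, g, h, hf, hg, hh, rfl, hF.strict_condition hf hg hh hA, fun x => (key x).1,
      fun x => (key x).2⟩
  · rintro ⟨f, g, h, hf, hg, hh, rfl, h0, h1, h2⟩
    rw [funext h1, funext h2]
    exact mem_tangentAtId_autContactStrict hf h0

/-- The divergence is `Af + (BC - CB) f / 2 = 2 Af`, by the commutator relation. -/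
theorem divergence_eq_zero {f g h : S3 → ℝ} (hf : IsSmooth f) (hg : IsSmooth g) (hh : IsSmooth h)
    (h0 : ∀ x, dirDeriv fieldA f x = 0) (h1 : ∀ x, g x = (1 / 2) * dirDeriv fieldC f x)
    (h2 : ∀ x, h x = -(1 / 2) * dirDeriv fieldB f x) (x : S3) :
    divergence (combo f g h) x = 0 := by
  rw [divergence_combo hf hg hh, funext h1, funext h2,
    dirDeriv_const_mul _ (isSmooth_dirDeriv inclDeriv_fieldC hf),
    dirDeriv_const_mul _ (isSmooth_dirDeriv inclDeriv_fieldB hf)]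
  have := dirDeriv_commutator hf x
  rw [h0] at this ⊢
  linarith

end HopfContact

end

theorem mainTheorem7 :
    (HopfContact.tangentAtId HopfContact.AutHopf =
      {X | ∃ f g h : HopfContact.S3 → ℝ,
        HopfContact.IsSmooth f ∧ HopfContact.IsSmooth g ∧ HopfContact.IsSmooth h ∧
        X = HopfContact.combo f g h ∧
        (∀ x, g x = -(1 / 2) * HopfContact.dirDeriv HopfContact.fieldA h x) ∧
        (∀ x, h x = (1 / 2) * HopfContact.dirDeriv HopfContact.fieldA g x)}) ∧
    (HopfContact.tangentAtId HopfContact.AutContact =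
      {X | ∃ f g h : HopfContact.S3 → ℝ,
        HopfContact.IsSmooth f ∧ HopfContact.IsSmooth g ∧ HopfContact.IsSmooth h ∧
        X = HopfContact.combo f g h ∧
        (∀ x, g x = (1 / 2) * HopfContact.dirDeriv HopfContact.fieldC f x) ∧
        (∀ x, h x = -(1 / 2) * HopfContact.dirDeriv HopfContact.fieldB f x)}) ∧
    (HopfContact.tangentAtId HopfContact.AutContactStrict =
      {X | ∃ f g h : HopfContact.S3 → ℝ,
        HopfContact.IsSmooth f ∧ HopfContact.IsSmooth g ∧ HopfContact.IsSmooth h ∧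
        X = HopfContact.combo f g h ∧
        (∀ x, HopfContact.dirDeriv HopfContact.fieldA f x = 0) ∧
        (∀ x, g x = (1 / 2) * HopfContact.dirDeriv HopfContact.fieldC f x) ∧
        (∀ x, h x = -(1 / 2) * HopfContact.dirDeriv HopfContact.fieldB f x)}) ∧
    (∀ f g h : HopfContact.S3 → ℝ,
      HopfContact.IsSmooth f → HopfContact.IsSmooth g → HopfContact.IsSmooth h →
      HopfContact.combo f g h ∈ HopfContact.tangentAtId HopfContact.AutContactStrict →
      (∀ x, ∀ y ∈ HopfContact.hopfFiber x, f y = f x) ∧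
      (∀ x, HopfContact.divergence (HopfContact.combo f g h) x = 0)) := by
  refine ⟨HopfContact.tangentAtId_autHopf, HopfContact.tangentAtId_autContact,
    HopfContact.tangentAtId_autContactStrict, fun f g h hf hg hh hX => ?_⟩
  rw [HopfContact.tangentAtId_autContactStrict] at hX
  obtain ⟨f', g', h', -, -, -, e, h0, h1, h2⟩ := hX
  -- The description of the tangent space only provides some coefficients; uniqueness in the frame
  -- identifies them with the given ones.
  obtain ⟨rfl, rfl, rfl⟩ := HopfContact.combo_injective e
  exact ⟨fun x y hy => HopfContact.eq_of_mem_hopfFiber hf h0 hy,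
    HopfContact.divergence_eq_zero hf hg hh h0 h1 h2⟩
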